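/- Throughout, let $G=(V,E)$ be a simple undirected graph on $n\ge 2$ vertices. A sequence of moves is a finite sequence $H=(\sigma_1,\dots,\sigma_m)$ of vertices; $\mathrm{len}(H)=m$, and $S(H)$ is the set of vertices that occur in $H$. A configuration of $S(H)$ is a map $\gamma:S(H)\to\{-1,1\}$; let $\gamma_i$ be the configuration obtained from $\gamma=\gamma_0$ by successively flipping the signs of $\sigma_1,\dots,\sigma_i$. An arc of $H$ is a pair $\alpha=(i,j)$, $i<j$, with $\sigma_i=\sigma_j$ and $\sigma_\ell\neq\sigma_i$ for all $i<\ell<j$. Its improvement vector $\mathrm{imprv}_{\gamma,H}(\alpha)\in\{-2,0,2\}^E$ has, for $u=\sigma_i$, the entry $2\gamma_{i-1}(u)\gamma_{i-1}(v)$ at each edge $\{u,v\}\in E$ such that $v$ occurs an odd number of times in $\sigma_{i+1},\dots,\sigma_{j-1}$, and all other entries $0$. For a set $Q$ of arcs of $H$, $\mathrm{rank}_H(Q)$ is the rank of the matrix whose columns are the vectors $\mathrm{imprv}_{\gamma_*,H}(\alpha)$, $\alpha\in Q$, where $\gamma_*$ is the configuration that is constantly $-1$ (the rank is the same for every other configuration).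 The sequence $H$ is nontrivial if every arc $(i,j)$ of $H$ has a position $k$ with $i<k<j$ such that $\sigma_k$ is adjacent to $\sigma_i$ and occurs an odd number of times in $\sigma_{i+1},\dots,\sigma_{j-1}$. **Lemma 3.1 (subsequence rank lemma).** There is an absolute constant $c>0$ such that the following holds for every $n\ge 2$ and every graph $G$ on $n$ vertices. For every nontrivial sequence $H$ of moves of length $5n$ and every configuration $\gamma$ of $S(H)$, there exist a nonempty sequence $B$ of moves of length at most $5n$, which is a subsequence of $H$, a configuration $\tau$ of $S(B)$, and a set $Q$ of arcs of $B$ such that 1. $\displaystyle \frac{\mathrm{rank}_B(Q)}{\mathrm{len}(B)}\ \ge\ \frac{c}{\sqrt{\log n}}$; 2. for every arc $\alpha\in Q$ there is an arc $\alpha'$ of $H$ with $\mathrm{imprv}_{\tau,B}(\alpha)=\mathrm{imprv}_{\gamma,H}(\alpha')$. -/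

import Mathlib

namespace LocalMaxCut

/-! A sequence of `m` moves of a graph on the vertex type `V` is a map `H : Fin m → V`
(positions are numbered from `0`). -/

/-- The set `S(H)` of active nodes: those that occur in the sequence `H`. -/
abbrev Active {V : Type*} {m : ℕ} (H : Fin m → V) : Set V := Set.range H

/-- A configuration of `S(H)`: a map from the active nodes to `{-1, 1}`. -/
abbrev Config {V : Type*} {m : ℕ} (H : Fin m → V) : Type _ := Active H → ℤˣ

open Classical in
/-- Number of occurrences of `v` among the moves of `H` before position `i`. -/
noncomputable def occBefore {V : Type*} {m : ℕ} (H : Fin m → V) (i : Fin m) (v : V) : ℕ :=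
  (Finset.univ.filter fun k : Fin m => k < i ∧ H k = v).card

open Classical in
/-- Number of occurrences of `v` among the moves strictly between the two positions of `α`. -/
noncomputable def occInside {V : Type*} {m : ℕ} (H : Fin m → V) (α : Fin m × Fin m) (v : V) : ℕ :=
  (Finset.univ.filter fun k : Fin m => α.1 < k ∧ k < α.2 ∧ H k = v).card

/-- `α = (i, j)` is an arc of `H`: positions `i < j` that hold two consecutive occurrences of
the same node. -/
def IsArc {V : Type*} {m : ℕ} (H : Fin m → V) (α : Fin m × Fin m) : Prop :=
  α.1 < α.2 ∧ H α.1 = H α.2 ∧ ∀ k, α.1 < k → k < α.2 → H k ≠ H α.1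

/-- The interior of `α`: the positions `k` strictly inside `α` such that the node `H k` occurs an
odd number of times strictly inside `α` and is adjacent to the node of `α`. -/
def interior {V : Type*} (G : SimpleGraph V) {m : ℕ} (H : Fin m → V) (α : Fin m × Fin m) :
    Set (Fin m) :=
  {k | α.1 < k ∧ k < α.2 ∧ Odd (occInside H α (H k)) ∧ G.Adj (H α.1) (H k)}

/-- A sequence is nontrivial if every arc of it has nonempty interior. -/
def IsNontrivial {V : Type*} (G : SimpleGraph V) {m : ℕ} (H : Fin m → V) : Prop :=
  ∀ α, IsArc H α → (interior G H α).Nonempty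

/-- The configuration of `S(H)` just before the move at position `i`, when the moves of `H` are
made one by one starting from `γ`: each move flips the sign of the node moved. -/
noncomputable def configBefore {V : Type*} {m : ℕ} (H : Fin m → V) (γ : Config H) (i : Fin m) :
    Config H :=
  fun v => (-1) ^ occBefore H i v * γ v

open Classical in
/-- The improvement vector of the arc `α = (i, j)` of `H` with respect to the initial
configuration `γ`, indexed by the edges of `G`. Its entry at `e` is nonzero iff `e = {u, v}` where
`u = H i` is the node of `α` and `v` occurs an odd number of times strictly inside `α`; the entry is
then `2 γ'(u) γ'(v)`, with `γ'` the configuration just before the move at position `i`.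
(Such a `v` is active and is determined by `e`, so at most one summand below is nonzero.) -/
noncomputable def improvement {V : Type*} (G : SimpleGraph V) {m : ℕ} (H : Fin m → V)
    (γ : Config H) (α : Fin m × Fin m) : G.edgeSet → ℤ :=
  fun e => ∑ v : Active H,
    if (e : Sym2 V) = s(H α.1, (v : V)) ∧ Odd (occInside H α v) then
      2 * (configBefore H γ α.1 ⟨H α.1, Set.mem_range_self α.1⟩ : ℤ) *
        (configBefore H γ α.1 v : ℤ)
    else 0

/-- The rank of a set `C` of arcs of `H` with respect to the initial configuration `γ`: the rank of
the real `|E| × |C|` matrix whose columns are the improvement vectors of the arcs in `C`. -/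
noncomputable def rankWith {V : Type*} (G : SimpleGraph V) {m : ℕ} (H : Fin m → V)
    (γ : Config H) (C : Finset (Fin m × Fin m)) : ℕ :=
  (Matrix.of fun (e : G.edgeSet) (α : C) => (improvement G H γ α e : ℝ)).rank

/-- The rank of a set `C` of arcs of `H`: the rank with respect to the default configuration that
maps every active node to `-1` (the rank does not depend on this choice). -/
noncomputable def rank {V : Type*} (G : SimpleGraph V) {m : ℕ} (H : Fin m → V)
    (C : Finset (Fin m × Fin m)) : ℕ :=
  rankWith G H (fun _ => -1) C

end LocalMaxCut

namespace LocalMaxCut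
open Classical

/-! ### Entries of improvement vectors -/

section Improvement
variable {V : Type*} {G : SimpleGraph V} {m : ℕ} {H : Fin m → V}

/-! Let `N` be the length of `H` and choose `K` of order `√(log N)` with `N < 2 ^ K ^ 2`, so that
there are about `K ^ 2` dyadic scales. Suppose that no subsequence has rank at least a `1 / (4 * C *
K)` fraction of its length, with `C = 1000`. Then every class of arcs below is small, whereas at
least `4 * N / 5` positions start an arc.

Rank comes from witnesses. If each arc of a family has a neighbour occurring oddly inside it, and
not oddly inside another arc of the family at the same node, then a two-colouring that separates
nodes from witnesses leaves a diagonal submatrix on a quarter of the arcs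
(`Witnessed.card_le_four_mul_rank`). By nontriviality, families with at most one arc per node are
witnessed. Cutting `H` into windows shows that arcs of length at most `2 ^ l` that are witnessed
within each block number at most `2 * N / (C * K)`. If each arc of a class fits into such a family
at `K` scales, double counting over at most `3 * K ^ 2` scales bounds the class by `6 * N / C`
(`card_mul_le_of_scales`).

This disposes of three classes: arcs much longer than the time since the previous move of their node
(`leftBad`), or than the time until its next move (`rightBad`), and arcs with an odd neighbour that
is absent from a long stretch around them (`richArcs`).

The remaining good arcs are treated one scale at a time. Choose good arcs of length about `2 ^ l` in
a window, one per node, and delete as many other moves as possible while keeping the parities that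
determine their improvement vectors. By minimality, the surviving moves can be charged to the chosen
arcs and to arcs of neighbouring nodes passing over their endpoints (`card_minimal_le`). Hence many
crossing arcs exist. Those shorter than `2 ^ (l - (K + 4))` are themselves witnessed, by the
isolated endpoint under them, and so are few. The longer ones have length within a factor of about
`2 ^ K` of `2 ^ l`, so an arc plays this role at only `O(K)` of the `K ^ 2` scales. Summing over
scales gives at most about `320 * N / C` good arcs (`card_goodArcs`), which is the contradiction. -/

lemma mem_active_of_odd_occInside {α : Fin m × Fin m} {v : V} (h : Odd (occInside H α v)) :
    v ∈ Active H := by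
  obtain ⟨k, hk⟩ := Finset.card_pos.mp h.pos
  exact ⟨k, (Finset.mem_filter.mp hk).2.2.2⟩

lemma improvement_eq_of_odd (γ : Config H) {α : Fin m × Fin m} {v : V} {e : G.edgeSet}
    (he : (e : Sym2 V) = s(H α.1, v)) (hv : Odd (occInside H α v)) :
    improvement G H γ α e =
      2 * (configBefore H γ α.1 ⟨H α.1, Set.mem_range_self α.1⟩ : ℤ) *
        (configBefore H γ α.1 ⟨v, mem_active_of_odd_occInside hv⟩ : ℤ) := by
  unfold improvement
  rw [Finset.sum_eq_single ⟨v, mem_active_of_odd_occInside hv⟩]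
  · rw [if_pos ⟨he, hv⟩]
  · intro b _ hb
    rw [if_neg]
    rintro ⟨h1, -⟩
    rw [he, Sym2.congr_right] at h1
    exact hb (Subtype.ext h1.symm)
  · intro h
    exact absurd (Finset.mem_univ _) h

lemma improvement_eq_zero (γ : Config H) {α : Fin m × Fin m} {e : G.edgeSet}
    (h : ∀ v, (e : Sym2 V) = s(H α.1, v) → ¬ Odd (occInside H α v)) :
    improvement G H γ α e = 0 := by
  unfold improvement
  refine Finset.sum_eq_zero fun v _ => if_neg ?_
  rintro ⟨h1, h2⟩
  exact h v h1 h2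

lemma improvement_ne_zero (γ : Config H) {α : Fin m × Fin m} {v : V} {e : G.edgeSet}
    (he : (e : Sym2 V) = s(H α.1, v)) (hv : Odd (occInside H α v)) :
    improvement G H γ α e ≠ 0 := by
  rw [improvement_eq_of_odd γ he hv]
  simp

end Improvement

/-- Some two-colouring separates at least a quarter of the given ordered pairs of distinct
vertices, in the prescribed direction. -/
lemma exists_coloring_quarter {V ι : Type*} [Finite V] (Q : Finset ι) (a b : ι → V)
    (hab : ∀ i ∈ Q, a i ≠ b i) :
    ∃ f : V → Bool, Q.card ≤ 4 * (Q.filter fun i => f (a i) = true ∧ f (b i) = false).card := by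
  have := Fintype.ofFinite V
  obtain ⟨f, hf⟩ : ∃ f : V → Bool, Q.card ≤ 2 * (Q.filter fun i => f (a i) ≠ f (b i)).card := by
    by_contra! hcon
    have h1 : ∑ f : V → Bool, 2 * (Q.filter fun i => f (a i) ≠ f (b i)).card <
        ∑ _f : V → Bool, Q.card :=
      Finset.sum_lt_sum_of_nonempty Finset.univ_nonempty fun f _ => hcon f
    have h2 : ∑ f : V → Bool, (Q.filter fun i => f (a i) ≠ f (b i)).card =
        ∑ i ∈ Q, ((Finset.univ : Finset (V → Bool)).filter fun f => f (a i) ≠ f (b i)).card :=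
      Finset.sum_card_bipartiteAbove_eq_sum_card_bipartiteBelow
        (fun (f : V → Bool) i => f (a i) ≠ f (b i))
    have h3 : ∀ i ∈ Q, 2 * ((Finset.univ : Finset (V → Bool)).filter
        fun f => f (a i) ≠ f (b i)).card = (Finset.univ : Finset (V → Bool)).card := by
      intro i hi
      rw [← Finset.card_filter_add_card_filter_not (s := (Finset.univ : Finset (V → Bool)))
        (fun f => f (a i) ≠ f (b i)), two_mul]
      congr 1
      -- Flipping the colour of `a i` is an involution exchanging the colourings that separate the
      -- pair with those that do not.
      refine Finset.card_bij' (fun f _ => Function.update f (a i) (!f (a i)))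
        (fun f _ => Function.update f (a i) (!f (a i))) ?_ ?_ ?_ ?_
      · intro f hf
        simp only [Finset.mem_filter, Finset.mem_univ, true_and, Function.update_self,
          Function.update_of_ne (hab i hi).symm] at hf ⊢
        revert hf
        cases f (a i) <;> cases f (b i) <;> simp
      · intro f hf
        simp only [Finset.mem_filter, Finset.mem_univ, true_and, Function.update_self,
          Function.update_of_ne (hab i hi).symm] at hf ⊢
        revert hf
        cases f (a i) <;> cases f (b i) <;> simp
      · intro f _; simp
      · intro f _; simp
    rw [← Finset.mul_sum, h2, Finset.mul_sum, Finset.sum_congr rfl h3] at h1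
    simp only [Finset.sum_const, smul_eq_mul] at h1
    rw [mul_comm] at h1
    exact lt_irrefl _ h1
  have hsplit : (Q.filter fun i => f (a i) ≠ f (b i)).card ≤
      (Q.filter fun i => f (a i) = true ∧ f (b i) = false).card +
      (Q.filter fun i => (!f (a i)) = true ∧ (!f (b i)) = false).card := by
    refine le_trans (Finset.card_le_card ?_) (Finset.card_union_le _ _)
    intro i hi
    simp only [Finset.mem_filter, Finset.mem_union] at hi ⊢
    obtain ⟨hi, h⟩ := hi
    revert h
    cases f (a i) <;> cases f (b i) <;> simp [hi]
  rcases le_total (Q.filter fun i => f (a i) = true ∧ f (b i) = false).card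
    (Q.filter fun i => (!f (a i)) = true ∧ (!f (b i)) = false).card with h | h
  · refine ⟨fun v => !f v, ?_⟩
    beta_reduce
    omega
  · exact ⟨f, by omega⟩

/-! ### Rank of witnessed families -/

section Rank
variable {V : Type*} (G : SimpleGraph V) {m : ℕ} (H : Fin m → V)

/-- Every arc of `A` has a neighbour occurring oddly inside it that does not occur oddly inside any
other arc of `A` at the same node. -/
def Witnessed (A : Finset (Fin m × Fin m)) : Prop :=
  ∃ w : Fin m × Fin m → V,
    (∀ α ∈ A, G.Adj (H α.1) (w α) ∧ Odd (occInside H α (w α))) ∧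
    ∀ α ∈ A, ∀ α' ∈ A, α ≠ α' → H α.1 = H α'.1 → ¬ Odd (occInside H α' (w α))

variable {G H}

/-- Keep the arcs whose node is coloured `true` and whose witness is coloured `false`. On the rows
given by the edges from node to witness, their columns form a diagonal matrix with nonzero diagonal,
hence are independent. -/
lemma Witnessed.card_le_four_mul_rank [Finite V] {A : Finset (Fin m × Fin m)}
    (hA : Witnessed G H A) : A.card ≤ 4 * rank G H A := by
  obtain ⟨w, hw, hsep⟩ := hA
  have := Fintype.ofFinite V
  obtain ⟨f, hf⟩ := exists_coloring_quarter A (fun α => H α.1) w fun α hα => (hw α hα).1.ne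
  refine hf.trans (Nat.mul_le_mul_left 4 ?_)
  set A' := A.filter fun i => f (H i.1) = true ∧ f (w i) = false with hA'
  have hsub : ∀ α : A', (α : Fin m × Fin m) ∈ A := fun α => (Finset.mem_filter.mp α.2).1
  let col : A → (G.edgeSet → ℝ) := fun α e => (improvement G H (fun _ => -1) α e : ℝ)
  let edge : A' → G.edgeSet := fun α => ⟨s(H α.1.1, w α), (hw α (hsub α)).1⟩
  have hdiag : ∀ α β : A', α ≠ β → col ⟨α, hsub α⟩ (edge β) = 0 := by
    intro α β hαβ
    simp only [col, Int.cast_eq_zero]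
    refine improvement_eq_zero _ ?_
    intro v hv hodd
    have hα := (Finset.mem_filter.mp α.2).2
    have hβ := (Finset.mem_filter.mp β.2).2
    simp only [edge] at hv
    rw [Sym2.eq_iff] at hv
    -- Either the two arcs share a node, which the separation of witnesses excludes, or the node of
    -- `α` is the witness of `β`, which the colouring excludes.
    rcases hv with ⟨h1, h2⟩ | ⟨h1, h2⟩
    · subst h2
      exact hsep β (hsub β) α (hsub α) (fun h => hαβ (Subtype.ext h.symm)) h1 hodd
    · rw [h2, hα.1] at hβ
      simp at hβ
  have hne : ∀ α : A', col ⟨α, hsub α⟩ (edge α) ≠ 0 := by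
    intro α
    simp only [col, ne_eq, Int.cast_eq_zero]
    exact improvement_ne_zero _ rfl (hw α (hsub α)).2
  have hli : LinearIndependent ℝ fun α : A' => col ⟨α, hsub α⟩ := by
    rw [Fintype.linearIndependent_iff]
    intro g hg α
    have h := congrFun hg (edge α)
    rw [Finset.sum_apply, Finset.sum_eq_single α] at h
    · simpa [hne α] using h
    · intro β _ hβ
      simp [hdiag β α hβ]
    · simp
  have hrank : rank G H A = Module.finrank ℝ (Submodule.span ℝ (Set.range col)) := by
    unfold rank rankWith
    rw [Matrix.rank_eq_finrank_span_cols]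
    rfl
  rw [hrank, ← Fintype.card_coe A', ← finrank_span_eq_card hli]
  have : FiniteDimensional ℝ (Submodule.span ℝ (Set.range col)) :=
    FiniteDimensional.span_of_finite ℝ (Set.finite_range _)
  refine Submodule.finrank_mono (Submodule.span_mono ?_)
  rintro _ ⟨α, rfl⟩
  exact ⟨⟨α, hsub α⟩, rfl⟩

end Rank

/-! ### Rank bounds from deleting moves -/

section Selection
variable {V : Type*} {G : SimpleGraph V} {N : ℕ} {H : Fin N → V}

/-- Some subsequence of `H` carries a set of arcs, with improvement vectors that occur in `H`,
whose rank is at least a `1 / c` fraction of the length of the subsequence. -/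
def RankBound (G : SimpleGraph V) {N : ℕ} (H : Fin N → V) (γ : Config H) (c : ℕ) : Prop :=
  ∃ (k : ℕ) (B : Fin k → V) (τ : Config B) (Q : Finset (Fin k × Fin k)),
    0 < k ∧ k ≤ N ∧ (∃ f : Fin k → Fin N, StrictMono f ∧ B = H ∘ f) ∧
    (∀ α ∈ Q, IsArc B α) ∧ k ≤ c * rank G B Q ∧
    ∀ α ∈ Q, ∃ α' : Fin N × Fin N, IsArc H α' ∧ improvement G B τ α = improvement G H γ α'

lemma card_filter_comp_orderEmb (S : Finset (Fin N)) (p : Fin N → Prop) [DecidablePred p] :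
    (Finset.univ.filter fun k : Fin S.card => p (S.orderEmbOfFin rfl k)).card =
      (S.filter p).card := by
  rw [← Finset.card_map (S.orderEmbOfFin rfl).toEmbedding]
  congr 1
  ext x
  simp only [Finset.mem_map, Finset.mem_filter, Finset.mem_univ, true_and,
    RelEmbedding.coe_toEmbedding]
  constructor
  · rintro ⟨k, hk, rfl⟩
    exact ⟨Finset.orderEmbOfFin_mem _ _ _, hk⟩
  · rintro ⟨hx, hp⟩
    have : x ∈ Set.range (S.orderEmbOfFin rfl) := by
      rw [Finset.range_orderEmbOfFin]; exact hx
    obtain ⟨k, rfl⟩ := this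
    exact ⟨k, hp, rfl⟩

lemma occInside_comp_orderEmb (S : Finset (Fin N)) (α : Fin S.card × Fin S.card) (v : V) :
    occInside (H ∘ S.orderEmbOfFin rfl) α v =
      (S.filter fun k => S.orderEmbOfFin rfl α.1 < k ∧ k < S.orderEmbOfFin rfl α.2 ∧
        H k = v).card := by
  rw [← card_filter_comp_orderEmb S fun k => S.orderEmbOfFin rfl α.1 < k ∧
    k < S.orderEmbOfFin rfl α.2 ∧ H k = v]
  simp [occInside]

lemma occBefore_comp_orderEmb (S : Finset (Fin N)) (i : Fin S.card) (v : V) :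
    occBefore (H ∘ S.orderEmbOfFin rfl) i v =
      (S.filter fun k => k < S.orderEmbOfFin rfl i ∧ H k = v).card := by
  rw [← card_filter_comp_orderEmb S fun k => k < S.orderEmbOfFin rfl i ∧ H k = v]
  simp [occBefore]

/-- Deleting the positions outside `S` preserves the improvement vectors of the arcs in `A` if it
preserves the relevant parities, up to a change of the initial configuration recorded by `s`. -/
theorem rankBound_of_selection [Finite V] (γ : Config H) {S : Finset (Fin N)}
    {A : Finset (Fin N × Fin N)} {s : V → ℕ} {c : ℕ} (hS : S.Nonempty)
    (hA : ∀ α ∈ A, IsArc H α ∧ α.1 ∈ S ∧ α.2 ∈ S) (hw : Witnessed G H A)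
    (hpar : ∀ α ∈ A, ∀ v, G.Adj (H α.1) v →
      (S.filter fun k => α.1 < k ∧ k < α.2 ∧ H k = v).card % 2 = occInside H α v % 2)
    (hsgn : ∀ α ∈ A, ∀ v, (v = H α.1 ∨ (G.Adj (H α.1) v ∧ Odd (occInside H α v))) →
      ((S.filter fun k => k < α.1 ∧ H k = v).card + s v) % 2 = occBefore H α.1 v % 2)
    (hc : S.card ≤ c * A.card) : RankBound G H γ (4 * c) := by
  set φ := S.orderEmbOfFin rfl with hφ
  let B : Fin S.card → V := H ∘ φ
  have hact : ∀ v ∈ Active B, v ∈ Active H := by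
    rintro _ ⟨k, rfl⟩
    exact ⟨φ k, rfl⟩
  -- The deleted moves may change the sign of a node before its first surviving move; `s` corrects
  -- the parity.
  let τ : Config B := fun v => (-1) ^ s v * γ ⟨v, hact v v.2⟩
  let Q : Finset (Fin S.card × Fin S.card) :=
    Finset.univ.filter fun α => (φ α.1, φ α.2) ∈ A
  have hex : ∀ x ∈ S, ∃ k, φ k = x := by
    intro x hx
    have : x ∈ Set.range φ := by
      rw [hφ, Finset.range_orderEmbOfFin]; exact hx
    exact this
  have hQA : Q.card = A.card := by
    refine Finset.card_bij (fun α _ => (φ α.1, φ α.2)) ?_ ?_ ?_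
    · intro α hα
      exact (Finset.mem_filter.mp hα).2
    · intro α _ β _ h
      simp only [Prod.mk.injEq, EmbeddingLike.apply_eq_iff_eq] at h
      exact Prod.ext h.1 h.2
    · rintro ⟨i, j⟩ hij
      obtain ⟨-, hi, hj⟩ := hA _ hij
      obtain ⟨k, hk⟩ := hex i hi
      obtain ⟨l, hl⟩ := hex j hj
      refine ⟨(k, l), ?_, by simp [hk, hl]⟩
      simp [Q, hk, hl, hij]
  have hmemQ : ∀ α, α ∈ Q ↔ (φ α.1, φ α.2) ∈ A := by
    intro α; simp [Q]
  have hodd : ∀ α ∈ Q, ∀ v, G.Adj (B α.1) v →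
      (Odd (occInside B α v) ↔ Odd (occInside H (φ α.1, φ α.2) v)) := by
    intro α hα v hv
    rw [Nat.odd_iff, Nat.odd_iff, occInside_comp_orderEmb,
      hpar _ ((hmemQ α).mp hα) v hv]
  have hQ : ∀ α ∈ Q, IsArc B α := by
    intro α hα
    obtain ⟨⟨h1, h2, h3⟩, -, -⟩ := hA _ ((hmemQ α).mp hα)
    refine ⟨by simpa using h1, h2, fun k hk1 hk2 => h3 (φ k) (by simpa using hk1)
      (by simpa using hk2)⟩
  have hWB : Witnessed G B Q := by
    obtain ⟨w, hw1, hw2⟩ := hw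
    refine ⟨fun α => w (φ α.1, φ α.2), ?_, ?_⟩
    · intro α hα
      have h := hw1 _ ((hmemQ α).mp hα)
      exact ⟨h.1, (hodd α hα _ h.1).mpr h.2⟩
    · intro α hα β hβ hαβ hn
      have h := hw1 _ ((hmemQ α).mp hα)
      rw [hodd β hβ _ (by rw [← hn]; exact h.1)]
      refine hw2 _ ((hmemQ α).mp hα) _ ((hmemQ β).mp hβ) ?_ hn
      intro heq
      simp only [Prod.mk.injEq, EmbeddingLike.apply_eq_iff_eq] at heq
      exact hαβ (Prod.ext heq.1 heq.2)
  refine ⟨S.card, B, τ, Q, hS.card_pos, by simpa using Finset.card_le_univ S,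
    ⟨φ, φ.strictMono, rfl⟩, hQ, ?_, ?_⟩
  · calc S.card ≤ c * A.card := hc
      _ ≤ c * (4 * rank G B Q) := by
        rw [← hQA]; exact Nat.mul_le_mul_left _ hWB.card_le_four_mul_rank
      _ = 4 * c * rank G B Q := by ring
  · intro α hα
    have hα' := (hmemQ α).mp hα
    refine ⟨(φ α.1, φ α.2), (hA _ hα').1, ?_⟩
    have hcfg : ∀ v (hv : v ∈ Active B),
        (v = H (φ α.1) ∨ (G.Adj (H (φ α.1)) v ∧ Odd (occInside H (φ α.1, φ α.2) v))) →
        configBefore B τ α.1 ⟨v, hv⟩ = configBefore H γ (φ α.1) ⟨v, hact v hv⟩ := by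
      intro v hv hrel
      have h := hsgn _ hα' v hrel
      simp only [configBefore, τ]
      rw [← mul_assoc, ← pow_add]
      congr 1
      refine neg_one_pow_congr ?_
      rw [Nat.even_iff, Nat.even_iff, occBefore_comp_orderEmb, h]
    funext e
    by_cases hv : ∃ v, (e : Sym2 V) = s(H (φ α.1), v) ∧ Odd (occInside H (φ α.1, φ α.2) v)
    · obtain ⟨v, he, hv⟩ := hv
      have hadj : G.Adj (H (φ α.1)) v := by
        have := e.2
        rw [he] at this
        exact this
      have hv' : Odd (occInside B α v) := (hodd α hα v hadj).mpr hv
      rw [improvement_eq_of_odd (H := B) τ (α := α) he hv',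
        improvement_eq_of_odd (H := H) γ (α := (φ α.1, φ α.2)) he hv]
      have h1 := hcfg (B α.1) (Set.mem_range_self _) (Or.inl rfl)
      have h2 := hcfg v (mem_active_of_odd_occInside hv') (Or.inr ⟨hadj, hv⟩)
      rw [h1, h2]
      rfl
    · push Not at hv
      rw [improvement_eq_zero (H := H) γ (α := (φ α.1, φ α.2)) (fun v hv' => by
        simpa using hv v hv')]
      refine improvement_eq_zero (H := B) τ (α := α) fun v he hodd' => ?_
      have hadj : G.Adj (H (φ α.1)) v := by
        have := e.2
        rw [show (e : Sym2 V) = s(H (φ α.1), v) from he] at this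
        exact this
      have := hv v he
      exact absurd ((hodd α hα v hadj).mp hodd') (by simpa using this)

/-- Number of occurrences of `v` before all the positions of the window `W`. -/
noncomputable def occPreceding (H : Fin N → V) (W : Finset (Fin N)) (v : V) : ℕ :=
  (Finset.univ.filter fun k => (∀ q ∈ W, k < q) ∧ H k = v).card

lemma card_filter_add_occPreceding {W : Finset (Fin N)}
    (hW : ∀ p ∈ W, ∀ r ∈ W, ∀ q, p < q → q < r → q ∈ W) {i : Fin N} (hi : i ∈ W) (v : V) :
    (W.filter fun k => k < i ∧ H k = v).card + occPreceding H W v = occBefore H i v := by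
  unfold occPreceding occBefore
  rw [← Finset.card_union_of_disjoint]
  · congr 1
    ext k
    simp only [Finset.mem_union, Finset.mem_filter, Finset.mem_univ, true_and]
    constructor
    · rintro (⟨-, h⟩ | ⟨h1, h2⟩)
      · exact h
      · exact ⟨h1 i hi, h2⟩
    · rintro ⟨h1, h2⟩
      by_cases hk : k ∈ W
      · exact Or.inl ⟨hk, h1, h2⟩
      · refine Or.inr ⟨fun q hq => ?_, h2⟩
        by_contra! hqk
        rcases hqk.eq_or_lt with h | h
        · exact hk (h ▸ hq)
        · exact hk (hW q hq i hi k h h1)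
  · rw [Finset.disjoint_left]
    intro k hk hk'
    simp only [Finset.mem_filter, Finset.mem_univ, true_and] at hk hk'
    exact lt_irrefl _ (hk'.1 k hk.1)

/-- A contiguous window keeps everything inside its arcs, so the only correction to the signs is by
the moves that precede the window. -/
theorem rankBound_of_window [Finite V] (γ : Config H) {W : Finset (Fin N)}
    {A : Finset (Fin N × Fin N)} {c : ℕ} (hWne : W.Nonempty)
    (hW : ∀ p ∈ W, ∀ r ∈ W, ∀ q, p < q → q < r → q ∈ W)
    (hA : ∀ α ∈ A, IsArc H α ∧ α.1 ∈ W ∧ α.2 ∈ W) (hw : Witnessed G H A)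
    (hc : W.card ≤ c * A.card) : RankBound G H γ (4 * c) := by
  refine rankBound_of_selection γ (s := occPreceding H W) hWne hA hw ?_ ?_ hc
  · intro α hα v _
    obtain ⟨-, h1, h2⟩ := hA α hα
    unfold occInside
    congr 2
    ext k
    simp only [Finset.mem_filter, Finset.mem_univ, true_and, and_iff_right_iff_imp]
    exact fun h => hW _ h1 _ h2 k h.1 h.2.1
  · intro α hα v _
    rw [card_filter_add_occPreceding hW (hA α hα).2.1]

end Selection

/-! ### Combinatorics of arcs -/

section Arcs
variable {V : Type*} {N : ℕ} {H : Fin N → V}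

/-- The set of arcs of `H`. -/
noncomputable def arcs (H : Fin N → V) : Finset (Fin N × Fin N) :=
  Finset.univ.filter (IsArc H)

lemma mem_arcs {α : Fin N × Fin N} : α ∈ arcs H ↔ IsArc H α := by simp [arcs]

/-- If `v` occurs at positions `p < q` and not at position `e` between them, some arc of `v` with
endpoints in `[p, q]` passes over `e`. -/
lemma exists_isArc_over {p e q : Fin N} (hpe : p < e) (heq : e < q) (hpq : H p = H q)
    (he : H e ≠ H p) :
    ∃ β : Fin N × Fin N, IsArc H β ∧ H β.1 = H p ∧ p ≤ β.1 ∧ β.1 < e ∧ e < β.2 ∧ β.2 ≤ q := by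
  have h1 : (Finset.univ.filter fun k : Fin N => k < e ∧ H k = H p).Nonempty :=
    ⟨p, by simp [hpe]⟩
  have h2 : (Finset.univ.filter fun k : Fin N => e < k ∧ H k = H p).Nonempty :=
    ⟨q, by simp [heq, hpq]⟩
  have m1 := Finset.max'_mem _ h1
  have m2 := Finset.min'_mem _ h2
  set a := Finset.max' _ h1 with ha
  set b := Finset.min' _ h2 with hb
  simp only [Finset.mem_filter, Finset.mem_univ, true_and] at m1 m2
  refine ⟨(a, b), ⟨m1.1.trans m2.1, m1.2.trans m2.2.symm, ?_⟩, m1.2, ?_, m1.1, m2.1, ?_⟩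
  · intro k hk1 hk2 hk
    have hk' : H k = H p := hk.trans m1.2
    rcases lt_trichotomy k e with h | h | h
    · exact absurd (Finset.le_max' _ k (by simp [h, hk'])) (not_le.mpr hk1)
    · exact he (h ▸ hk')
    · exact absurd (Finset.min'_le _ k (by simp [h, hk'])) (not_le.mpr hk2)
  · exact Finset.le_max' _ p (by simp [hpe])
  · exact Finset.min'_le _ q (by simp [heq, hpq])

lemma exists_isArc_right {i p : Fin N} (hip : i < p) (h : H p = H i) :
    ∃ j, IsArc H (i, j) ∧ j ≤ p := by
  have h1 : (Finset.univ.filter fun k : Fin N => i < k ∧ H k = H i).Nonempty :=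
    ⟨p, by simp [hip, h]⟩
  have m1 := Finset.min'_mem _ h1
  simp only [Finset.mem_filter, Finset.mem_univ, true_and] at m1
  refine ⟨Finset.min' _ h1, ⟨m1.1, m1.2.symm, ?_⟩, Finset.min'_le _ p (by simp [hip, h])⟩
  intro k hk1 hk2 hk
  exact absurd (Finset.min'_le _ k (by simpa [hk] using hk1)) (not_le.mpr hk2)

lemma exists_isArc_left {i p : Fin N} (hip : p < i) (h : H p = H i) :
    ∃ j, IsArc H (j, i) ∧ p ≤ j := by
  have h1 : (Finset.univ.filter fun k : Fin N => k < i ∧ H k = H i).Nonempty :=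
    ⟨p, by simp [hip, h]⟩
  have m1 := Finset.max'_mem _ h1
  simp only [Finset.mem_filter, Finset.mem_univ, true_and] at m1
  refine ⟨Finset.max' _ h1, ⟨m1.1, m1.2, ?_⟩, Finset.le_max' _ p (by simp [hip, h])⟩
  intro k hk1 hk2 hk
  exact absurd (Finset.le_max' _ k (by simpa [hk, m1.2] using hk2)) (not_le.mpr hk1)

lemma IsArc.eq_of_fst_eq {α β : Fin N × Fin N} (hα : IsArc H α) (hβ : IsArc H β)
    (h : α.1 = β.1) : α = β := by
  obtain ⟨i, j⟩ := α
  obtain ⟨i', j'⟩ := β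
  obtain ⟨a1, a2, a3⟩ := hα
  obtain ⟨b1, b2, b3⟩ := hβ
  simp only at *
  subst h
  rcases lt_trichotomy j j' with h | h | h
  · exact absurd a2.symm (b3 j a1 h)
  · rw [h]
  · exact absurd b2.symm (a3 j' b1 h)

lemma IsArc.eq_of_snd_eq {α β : Fin N × Fin N} (hα : IsArc H α) (hβ : IsArc H β)
    (h : α.2 = β.2) : α = β := by
  refine hα.eq_of_fst_eq hβ ?_
  obtain ⟨i, j⟩ := α
  obtain ⟨i', j'⟩ := β
  obtain ⟨a1, a2, a3⟩ := hα
  obtain ⟨b1, b2, b3⟩ := hβ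
  simp only at *
  subst h
  rcases lt_trichotomy i i' with h | h | h
  · exact absurd (b2.trans a2.symm) (a3 i' h b1)
  · exact h
  · exact absurd (a2.trans b2.symm) (b3 i h a1)

/-- Distinct arcs at the same node do not overlap. -/
lemma IsArc.le_or_le {α β : Fin N × Fin N} (hα : IsArc H α) (hβ : IsArc H β)
    (hn : H α.1 = H β.1) (hne : α ≠ β) : α.2 ≤ β.1 ∨ β.2 ≤ α.1 := by
  rcases lt_trichotomy α.1 β.1 with h | h | h
  · left
    by_contra! hlt
    exact hα.2.2 _ h hlt hn.symm
  · exact absurd (hα.eq_of_fst_eq hβ h) hne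
  · right
    by_contra! hlt
    exact hβ.2.2 _ h hlt hn

/-- A position that starts no arc is the last occurrence of its node, so there is at most one such
position per node. -/
lemma card_le_card_arcs_add [Fintype V] (H : Fin N → V) :
    N ≤ (arcs H).card + Fintype.card V := by
  have h1 : ((arcs H).image Prod.fst).card ≤ (arcs H).card := Finset.card_image_le
  have h2 : (((arcs H).image Prod.fst)ᶜ).card ≤ (Finset.univ : Finset V).card := by
    refine Finset.card_le_card_of_injOn H (fun _ _ => Finset.mem_univ _) ?_
    have key : ∀ i ∈ ((arcs H).image Prod.fst)ᶜ, ∀ j, i < j → H i ≠ H j := by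
      intro i hi j hij hH
      obtain ⟨k, hk, -⟩ := exists_isArc_right hij hH.symm
      rw [Finset.mem_compl] at hi
      exact hi (Finset.mem_image.mpr ⟨(i, k), mem_arcs.mpr hk, rfl⟩)
    intro i hi j hj hH
    rcases lt_trichotomy i j with h | h | h
    · exact absurd hH (key i hi j h)
    · exact h
    · exact absurd hH.symm (key j hj i h)
  have h3 := Finset.card_add_card_compl ((arcs H).image Prod.fst)
  simp only [Fintype.card_fin, Finset.card_univ] at h2 h3
  omega

end Arcs

/-! ### Windows and double counting over scales -/

section Window
variable {V : Type*} {G : SimpleGraph V} {N : ℕ} {H : Fin N → V}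

/-- Two consecutive blocks of length `Λ`, starting with block number `t`. -/
def window (N Λ t : ℕ) : Finset (Fin N) :=
  Finset.univ.filter fun p => p.val / Λ = t ∨ p.val / Λ = t + 1

lemma mem_window {Λ t : ℕ} {p : Fin N} :
    p ∈ window N Λ t ↔ p.val / Λ = t ∨ p.val / Λ = t + 1 := by
  simp [window]

lemma mem_window_iff {Λ t : ℕ} (hΛ : 0 < Λ) {p : Fin N} :
    p ∈ window N Λ t ↔ t * Λ ≤ p.val ∧ p.val < t * Λ + 2 * Λ := by
  rw [mem_window, Nat.div_eq_iff hΛ, Nat.div_eq_iff hΛ, add_mul]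
  constructor
  · rintro (⟨h1, h2⟩ | ⟨h1, h2⟩) <;> constructor <;> omega
  · rintro ⟨h1, h2⟩
    omega

lemma ordConnected_window {Λ t : ℕ} :
    ∀ p ∈ window N Λ t, ∀ r ∈ window N Λ t, ∀ q, p < q → q < r → q ∈ window N Λ t := by
  intro p hp r hr q hpq hqr
  rw [mem_window] at *
  have h1 : p.val / Λ ≤ q.val / Λ := Nat.div_le_div_right (le_of_lt hpq)
  have h2 : q.val / Λ ≤ r.val / Λ := Nat.div_le_div_right (le_of_lt hqr)
  omega

lemma mem_window_of_le {Λ : ℕ} (hΛ : 0 < Λ) {p q : Fin N} (hpq : p ≤ q)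
    (hq : q.val ≤ p.val + Λ) : q ∈ window N Λ (p.val / Λ) := by
  rw [mem_window_iff hΛ]
  have h1 := Nat.div_mul_le_self p.val Λ
  have h2 := Nat.lt_div_mul_add hΛ (a := p.val)
  have h3 : p.val ≤ q.val := hpq
  omega

/-- Consecutive windows overlap in one block, so each position lies in at most two of them. -/
lemma sum_card_filter_window {ι : Type*} (X : Finset ι) (f : ι → Fin N) (Λ T : ℕ) :
    ∑ t ∈ Finset.range T, (X.filter fun x => f x ∈ window N Λ t).card ≤ 2 * X.card := by
  have h := Finset.sum_card_bipartiteAbove_eq_sum_card_bipartiteBelow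
    (s := Finset.range T) (t := X) (fun t x => f x ∈ window N Λ t)
  unfold Finset.bipartiteAbove Finset.bipartiteBelow at h
  rw [h, mul_comm]
  refine Finset.sum_le_card_nsmul _ _ _ fun x _ => ?_
  refine (Finset.card_le_card (t := {(f x).val / Λ, (f x).val / Λ - 1}) ?_).trans
    Finset.card_le_two
  intro t ht
  rw [Finset.mem_filter] at ht
  beta_reduce at ht
  rw [mem_window] at ht
  simp only [Finset.mem_insert, Finset.mem_singleton]
  omega

lemma sum_card_window (N Λ T : ℕ) :
    ∑ t ∈ Finset.range T, (window N Λ t).card ≤ 2 * N := by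
  have h := sum_card_filter_window (Finset.univ : Finset (Fin N)) id Λ T
  simpa using h

lemma witnessed_of_forall_exists {A : Finset (Fin N × Fin N)}
    (h : ∀ α ∈ A, ∃ v, G.Adj (H α.1) v ∧ Odd (occInside H α v) ∧
      ∀ α' ∈ A, α ≠ α' → H α.1 = H α'.1 → ¬ Odd (occInside H α' v)) : Witnessed G H A := by
  refine ⟨fun α => if hα : α ∈ A then (h α hα).choose else H α.1, ?_, ?_⟩
  · intro α hα
    beta_reduce
    rw [dif_pos hα]
    exact ⟨(h α hα).choose_spec.1, (h α hα).choose_spec.2.1⟩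
  · intro α hα
    beta_reduce
    rw [dif_pos hα]
    exact (h α hα).choose_spec.2.2

/-- Nontriviality supplies an odd neighbour for each arc, and the separation condition is vacuous
when no node is repeated. -/
lemma witnessed_of_unique (hn : IsNontrivial G H) {A : Finset (Fin N × Fin N)}
    (hA : ∀ α ∈ A, IsArc H α) (hu : ∀ α ∈ A, ∀ β ∈ A, H α.1 = H β.1 → α = β) :
    Witnessed G H A := by
  refine witnessed_of_forall_exists fun α hα => ?_
  obtain ⟨k, -, -, h1, h2⟩ := hn α (hA α hα)
  exact ⟨H k, h2, h1, fun β hβ hne hαβ => absurd (hu α hα β hβ hαβ) hne⟩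

lemma mul_card_le_card_window [Finite V] {γ : Config H} {c Λ t : ℕ}
    (hno : ¬ RankBound G H γ (4 * c)) {X : Finset (Fin N × Fin N)}
    (hX : ∀ α ∈ X, IsArc H α ∧ α.1 ∈ window N Λ t ∧ α.2 ∈ window N Λ t)
    (hw : Witnessed G H X) : c * X.card ≤ (window N Λ t).card := by
  rcases X.eq_empty_or_nonempty with h | ⟨α, hα⟩
  · simp [h]
  by_contra! hlt
  exact hno (rankBound_of_window γ ⟨α.1, (hX α hα).2.1⟩ ordConnected_window hX hw hlt.le)

lemma card_eq_sum_range_filter (X : Finset (Fin N × Fin N)) (Λ : ℕ) :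
    X.card = ∑ t ∈ Finset.range N, (X.filter fun α => α.1.val / Λ = t).card := by
  refine Finset.card_eq_sum_card_fiberwise fun α _ => ?_
  simp only [Finset.coe_range, Set.mem_Iio]
  exact (Nat.div_le_self _ _).trans_lt α.1.isLt

/-- Witnessed families of arcs at a single scale have density at most `2 / c`. -/
lemma mul_card_le_of_witnessed [Finite V] {γ : Config H} {c Λ : ℕ} (hΛ : 0 < Λ)
    (hno : ¬ RankBound G H γ (4 * c)) {X : Finset (Fin N × Fin N)}
    (hX : ∀ α ∈ X, IsArc H α ∧ α.2.val ≤ α.1.val + Λ)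
    (hw : ∀ t, Witnessed G H (X.filter fun α => α.1.val / Λ = t)) : c * X.card ≤ 2 * N := by
  rw [card_eq_sum_range_filter X Λ, Finset.mul_sum]
  refine le_trans (Finset.sum_le_sum fun t _ => ?_) (sum_card_window N Λ N)
  refine mul_card_le_card_window hno ?_ (hw t)
  intro α hα
  obtain ⟨hαX, rfl⟩ := Finset.mem_filter.mp hα
  obtain ⟨h1, h2⟩ := hX α hαX
  exact ⟨h1, mem_window_of_le hΛ le_rfl (by omega), mem_window_of_le hΛ h1.1.le h2⟩

/-- Double counting of pairs of an element and a scale: seeing every element at `K` consecutive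
scales gains a factor `K` over the bound at one scale. -/
lemma card_mul_le_of_scales {ι : Type*} {X : Finset ι} {R : ι → ℕ → Prop} {c K M B : ℕ}
    (hR : ∀ l < M, c * (X.filter fun x => R x l).card ≤ B)
    (hK : ∀ x ∈ X, ∃ a, ∀ s < K, a + s < M ∧ R x (a + s)) :
    c * (X.card * K) ≤ M * B := by
  have h := Finset.sum_card_bipartiteAbove_eq_sum_card_bipartiteBelow
    (s := X) (t := Finset.range M) R
  unfold Finset.bipartiteAbove Finset.bipartiteBelow at h
  have h1 : X.card * K ≤ ∑ x ∈ X, ((Finset.range M).filter (R x)).card := by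
    refine Finset.card_nsmul_le_sum _ _ _ fun x hx => ?_
    obtain ⟨a, ha⟩ := hK x hx
    calc K = ((Finset.range K).map (addLeftEmbedding a)).card := by simp
      _ ≤ _ := by
        refine Finset.card_le_card fun l hl => ?_
        simp only [Finset.mem_map, Finset.mem_range, addLeftEmbedding_apply] at hl
        obtain ⟨s, hs, rfl⟩ := hl
        simp [(ha s hs).1, (ha s hs).2]
  calc c * (X.card * K) ≤ c * ∑ l ∈ Finset.range M, (X.filter fun x => R x l).card := by
        rw [← h]; exact Nat.mul_le_mul_left _ h1
    _ = ∑ l ∈ Finset.range M, c * (X.filter fun x => R x l).card := Finset.mul_sum _ _ _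
    _ ≤ M * B := by
        have := Finset.sum_le_card_nsmul (Finset.range M) _ B
          fun l hl => hR l (Finset.mem_range.mp hl)
        simpa using this

lemma exists_two_pow_near {x : ℕ} (hx : 0 < x) : ∃ a, x ≤ 2 ^ a ∧ 2 ^ a < 2 * x := by
  refine ⟨Nat.clog 2 x, Nat.le_pow_clog (by norm_num) x, ?_⟩
  rcases Nat.lt_or_ge 1 x with h | h
  · have h1 := Nat.pow_pred_clog_lt_self (b := 2) (by norm_num) h
    have h2 : 0 < Nat.clog 2 x := Nat.clog_pos (by norm_num) h
    obtain ⟨y, hy⟩ : ∃ y, Nat.clog 2 x = y + 1 := ⟨Nat.clog 2 x - 1, by omega⟩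
    rw [hy, Nat.pred_succ] at h1
    rw [hy, pow_succ]
    omega
  · have : x = 1 := by omega
    subst this
    simp

end Window

/-! ### Arcs visible at many scales: short neighbouring arcs and rich arcs -/

section Gap
variable {V : Type*} {G : SimpleGraph V} {N : ℕ} {H : Fin N → V}

/-- Arcs whose node was last moved a very short time before, relative to the length of the arc. -/
noncomputable def leftBad (H : Fin N → V) (M : ℕ) : Finset (Fin N × Fin N) :=
  (arcs H).filter fun α => ∃ p, p < α.1 ∧ H p = H α.1 ∧
    M * (α.1.val - p.val) ≤ α.2.val - α.1.val

/-- Arcs whose node is next moved a very short time after, relative to the length of the arc. -/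
noncomputable def rightBad (H : Fin N → V) (M : ℕ) : Finset (Fin N × Fin N) :=
  (arcs H).filter fun α => ∃ p, α.2 < p ∧ H p = H α.1 ∧
    M * (p.val - α.2.val) ≤ α.2.val - α.1.val

/-- A ratio of at least `2 ^ (K + 2)` leaves room for `K` powers of two between `x` and `y / 2`; the
two spare factors of two pay for rounding `x` up to a power and for halving `y`. -/
lemma two_pow_gap {K N x y : ℕ} (hN : N < 2 ^ K ^ 2) (hx : 0 < x)
    (hxy : 2 ^ (K + 2) * x ≤ y) (hy : y ≤ N) :
    ∃ a, ∀ s < K, a + s < 3 * K ^ 2 ∧ x ≤ 2 ^ (a + s) ∧ 2 * 2 ^ (a + s) ≤ y := by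
  obtain ⟨a, ha1, ha2⟩ := exists_two_pow_near hx
  refine ⟨a, fun s hs => ?_⟩
  have h1 : 2 ^ a ≤ 2 ^ (a + s) := Nat.pow_le_pow_right (by norm_num) (by omega)
  have h2 : 2 * 2 ^ (a + s) ≤ y := by
    have : 2 ^ s ≤ 2 ^ K := Nat.pow_le_pow_right (by norm_num) hs.le
    calc 2 * 2 ^ (a + s) = 2 * (2 ^ a * 2 ^ s) := by rw [pow_add]
      _ ≤ 2 * (2 * x * 2 ^ K) := by gcongr
      _ = 2 ^ (K + 2) * x := by ring
      _ ≤ y := hxy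
  refine ⟨?_, ha1.trans h1, h2⟩
  have h3 : a + s < K ^ 2 := by
    rw [← Nat.pow_lt_pow_iff_right (a := 2) (by norm_num)]
    omega
  omega

lemma cancel_scales {C K X N : ℕ} (hK : 1 ≤ K)
    (h : C * K * (X * K) ≤ 3 * K ^ 2 * (2 * N)) : C * X ≤ 6 * N := by
  have : K ^ 2 * (C * X) ≤ K ^ 2 * (6 * N) := by nlinarith
  exact Nat.le_of_mul_le_mul_left this (by positivity)

/-- Replace each bad arc by the short arc that ends where it starts. At every scale between the two
lengths, the short arc is the last arc of its node in its window, so at most one arc per node is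
counted there. -/
lemma card_leftBad [Finite V] {γ : Config H} {C K : ℕ} (hK : 1 ≤ K) (hN : N < 2 ^ K ^ 2)
    (hn : IsNontrivial G H) (hno : ¬ RankBound G H γ (4 * (C * K))) :
    C * (leftBad H (2 ^ (K + 2))).card ≤ 6 * N := by
  let X : Finset (Fin N × Fin N) := (arcs H).filter fun β => ∃ j, IsArc H (β.2, j) ∧
    2 ^ (K + 2) * (β.2.val - β.1.val) ≤ j.val - β.2.val
  have hcard : (leftBad H (2 ^ (K + 2))).card ≤ X.card := by
    rw [← Finset.card_image_of_injOn (s := leftBad H (2 ^ (K + 2))) (f := Prod.fst)]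
    · refine le_trans (Finset.card_le_card ?_) (Finset.card_image_le (s := X) (f := Prod.snd))
      intro i hi
      obtain ⟨⟨i', j⟩, hα, rfl⟩ := Finset.mem_image.mp hi
      obtain ⟨harc, p, hp1, hp2, hp3⟩ := Finset.mem_filter.mp hα
      rw [mem_arcs] at harc
      obtain ⟨h, hh1, hh2⟩ := exists_isArc_left hp1 hp2
      refine Finset.mem_image.mpr ⟨(h, i'), Finset.mem_filter.mpr ⟨mem_arcs.mpr hh1, j, harc, ?_⟩,
        rfl⟩
      refine le_trans (Nat.mul_le_mul_left _ ?_) hp3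
      have : p.val ≤ h.val := hh2
      simp only
      omega
    · intro α hα β hβ h
      exact (mem_arcs.mp (Finset.mem_filter.mp hα).1).eq_of_fst_eq
        (mem_arcs.mp (Finset.mem_filter.mp hβ).1) h
  refine le_trans (Nat.mul_le_mul_left _ hcard) (cancel_scales hK ?_)
  refine card_mul_le_of_scales (R := fun β l => β.2.val ≤ β.1.val + 2 ^ l ∧
    ∀ p, β.2 < p → H p = H β.1 → β.2.val + 2 * 2 ^ l ≤ p.val) ?_ ?_
  · intro l _
    refine mul_card_le_of_witnessed (Λ := 2 ^ l) (by positivity) hno ?_ ?_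
    · intro α hα
      simp only [X, Finset.mem_filter, mem_arcs] at hα
      exact ⟨hα.1.1, hα.2.1⟩
    · intro t
      -- The next move of the node after `α.2` is at least two block lengths later, hence outside
      -- the window, so no arc of that node can end there later than `α`.
      have key : ∀ α ∈ arcs H, ∀ β ∈ arcs H,
          (∀ p, α.2 < p → H p = H α.1 → α.2.val + 2 * 2 ^ l ≤ p.val) →
          α.1.val / 2 ^ l = t → β.2.val ≤ β.1.val + 2 ^ l → β.1.val / 2 ^ l = t →
          H α.1 = H β.1 → ¬ α.2 < β.2 := by
        intro α hα β hβ h1 h2 h3 h4 hH hlt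
        rw [mem_arcs] at hα hβ
        have h5 := h1 β.2 hlt (by rw [hH, hβ.2.1])
        have hpos : 0 < 2 ^ l := by positivity
        have h6 : β.2 ∈ window N (2 ^ l) t := h4 ▸ mem_window_of_le hpos hβ.1.le h3
        have h7 : α.1 ∈ window N (2 ^ l) t := by rw [mem_window]; exact Or.inl h2
        rw [mem_window_iff hpos] at h6 h7
        have h8 : α.1.val < α.2.val := hα.1
        omega
      refine witnessed_of_unique hn ?_ ?_
      · intro α hα
        simp only [X, Finset.mem_filter, mem_arcs] at hα
        exact hα.1.1.1
      · intro α hα β hβ hH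
        simp only [X, Finset.mem_filter] at hα hβ
        obtain ⟨⟨⟨a1, -⟩, a3, a4⟩, a5⟩ := hα
        obtain ⟨⟨⟨b1, -⟩, b3, b4⟩, b5⟩ := hβ
        refine (mem_arcs.mp a1).eq_of_snd_eq (mem_arcs.mp b1) (le_antisymm ?_ ?_)
        · exact not_lt.mp (key β b1 α a1 b4 b5 a3 a5 hH.symm)
        · exact not_lt.mp (key α a1 β b1 a4 a5 b3 b5 hH)
  · intro β hβ
    simp only [X, Finset.mem_filter, mem_arcs] at hβ
    obtain ⟨hβ, j, hj, hM⟩ := hβ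
    have h1 : β.1.val < β.2.val := hβ.1
    obtain ⟨a, ha⟩ := two_pow_gap hN (x := β.2.val - β.1.val) (by omega) hM (by omega)
    refine ⟨a, fun s hs => ?_⟩
    obtain ⟨h2, h3, h4⟩ := ha s hs
    refine ⟨h2, by omega, fun p hp hHp => ?_⟩
    have : ¬ p < j := fun hpj => hj.2.2 p hp hpj (hHp.trans hβ.2.1)
    have : j.val ≤ p.val := not_lt.mp this
    omega

/-- The mirror image of `card_leftBad`: the short arc following a bad arc is the first of its node
to start in its block. -/
lemma card_rightBad [Finite V] {γ : Config H} {C K : ℕ} (hK : 1 ≤ K) (hN : N < 2 ^ K ^ 2)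
    (hn : IsNontrivial G H) (hno : ¬ RankBound G H γ (4 * (C * K))) :
    C * (rightBad H (2 ^ (K + 2))).card ≤ 6 * N := by
  let X : Finset (Fin N × Fin N) := (arcs H).filter fun β => ∃ i, IsArc H (i, β.1) ∧
    2 ^ (K + 2) * (β.2.val - β.1.val) ≤ β.1.val - i.val
  have hcard : (rightBad H (2 ^ (K + 2))).card ≤ X.card := by
    rw [← Finset.card_image_of_injOn (s := rightBad H (2 ^ (K + 2))) (f := Prod.snd)]
    · refine le_trans (Finset.card_le_card ?_) (Finset.card_image_le (s := X) (f := Prod.fst))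
      intro i hi
      obtain ⟨⟨i', j⟩, hα, rfl⟩ := Finset.mem_image.mp hi
      obtain ⟨harc, p, hp1, hp2, hp3⟩ := Finset.mem_filter.mp hα
      rw [mem_arcs] at harc
      obtain ⟨h, hh1, hh2⟩ := exists_isArc_right hp1 (hp2.trans harc.2.1)
      refine Finset.mem_image.mpr ⟨(j, h), Finset.mem_filter.mpr ⟨mem_arcs.mpr hh1, i', harc, ?_⟩,
        rfl⟩
      refine le_trans (Nat.mul_le_mul_left _ ?_) hp3
      have : h.val ≤ p.val := hh2
      simp only
      omega
    · intro α hα β hβ h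
      exact (mem_arcs.mp (Finset.mem_filter.mp hα).1).eq_of_snd_eq
        (mem_arcs.mp (Finset.mem_filter.mp hβ).1) h
  refine le_trans (Nat.mul_le_mul_left _ hcard) (cancel_scales hK ?_)
  refine card_mul_le_of_scales (R := fun β l => β.2.val ≤ β.1.val + 2 ^ l ∧
    ∀ p, p < β.1 → H p = H β.1 → p.val + 2 * 2 ^ l ≤ β.1.val) ?_ ?_
  · intro l _
    refine mul_card_le_of_witnessed (Λ := 2 ^ l) (by positivity) hno ?_ ?_
    · intro α hα
      simp only [X, Finset.mem_filter, mem_arcs] at hα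
      exact ⟨hα.1.1, hα.2.1⟩
    · intro t
      have key : ∀ α : Fin N × Fin N, ∀ β : Fin N × Fin N,
          (∀ p, p < α.1 → H p = H α.1 → p.val + 2 * 2 ^ l ≤ α.1.val) →
          α.1.val / 2 ^ l = t → β.1.val / 2 ^ l = t → H α.1 = H β.1 → ¬ β.1 < α.1 := by
        intro α β h1 h2 h4 hH hlt
        have h5 := h1 β.1 hlt hH.symm
        have hpos : 0 < 2 ^ l := by positivity
        have h6 : β.1 ∈ window N (2 ^ l) t := by rw [mem_window]; exact Or.inl h4
        have h7 := Nat.lt_div_mul_add hpos (a := α.1.val)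
        rw [mem_window_iff hpos] at h6
        rw [h2] at h7
        omega
      refine witnessed_of_unique hn ?_ ?_
      · intro α hα
        simp only [X, Finset.mem_filter, mem_arcs] at hα
        exact hα.1.1.1
      · intro α hα β hβ hH
        simp only [X, Finset.mem_filter] at hα hβ
        obtain ⟨⟨⟨a1, -⟩, a3, a4⟩, a5⟩ := hα
        obtain ⟨⟨⟨b1, -⟩, b3, b4⟩, b5⟩ := hβ
        refine (mem_arcs.mp a1).eq_of_fst_eq (mem_arcs.mp b1) (le_antisymm ?_ ?_)
        · exact not_lt.mp (key α β a4 a5 b5 hH)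
        · exact not_lt.mp (key β α b4 b5 a5 hH.symm)
  · intro β hβ
    simp only [X, Finset.mem_filter, mem_arcs] at hβ
    obtain ⟨hβ, i, hi, hM⟩ := hβ
    have h1 : β.1.val < β.2.val := hβ.1
    obtain ⟨a, ha⟩ := two_pow_gap hN (x := β.2.val - β.1.val) (by omega) hM (by omega)
    refine ⟨a, fun s hs => ?_⟩
    obtain ⟨h2, h3, h4⟩ := ha s hs
    refine ⟨h2, by omega, fun p hp hHp => ?_⟩
    have : ¬ i < p := fun hpj => hi.2.2 p hpj hp (hHp.trans hi.2.1.symm)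
    have : p.val ≤ i.val := not_lt.mp this
    omega

/-- Arcs `α` having a neighbour that occurs oddly inside `α` and that occurs, within distance `M`
times the length of `α`, only inside `α`. -/
noncomputable def richArcs (G : SimpleGraph V) (H : Fin N → V) (M : ℕ) :
    Finset (Fin N × Fin N) :=
  (arcs H).filter fun α => ∃ v, G.Adj (H α.1) v ∧ Odd (occInside H α v) ∧
    ∀ p, H p = v → α.1.val ≤ p.val + M * (α.2.val - α.1.val) →
      p.val ≤ α.2.val + M * (α.2.val - α.1.val) → α.1 < p ∧ p < α.2

/-- At each scale between the length of the arc and `2 ^ K` times it, the whole window lies in the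
stretch where `v` occurs only inside the arc. Since arcs at one node do not overlap, `v` is a
witness. -/
lemma card_richArcs [Finite V] {γ : Config H} {C K : ℕ} (hK : 1 ≤ K) (hN : N < 2 ^ K ^ 2)
    (hno : ¬ RankBound G H γ (4 * (C * K))) :
    C * (richArcs G H (2 ^ (K + 1))).card ≤ 6 * N := by
  refine cancel_scales hK ?_
  refine card_mul_le_of_scales (R := fun α l => α.2.val ≤ α.1.val + 2 ^ l ∧
    2 * 2 ^ l ≤ 2 ^ (K + 1) * (α.2.val - α.1.val)) ?_ ?_
  · intro l _
    refine mul_card_le_of_witnessed (Λ := 2 ^ l) (by positivity) hno ?_ ?_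
    · intro α hα
      simp only [richArcs, Finset.mem_filter, mem_arcs] at hα
      exact ⟨hα.1.1, hα.2.1⟩
    · intro t
      have hpos : 0 < 2 ^ l := by positivity
      refine witnessed_of_forall_exists fun α hα => ?_
      simp only [richArcs, Finset.mem_filter, mem_arcs] at hα
      obtain ⟨⟨⟨a1, v, a2, a3, a4⟩, a5, a6⟩, a7⟩ := hα
      refine ⟨v, a2, a3, fun β hβ hne hH hodd => ?_⟩
      simp only [richArcs, Finset.mem_filter, mem_arcs] at hβ
      obtain ⟨⟨⟨b1, -⟩, b5, -⟩, b7⟩ := hβ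
      obtain ⟨k, hk⟩ := Finset.card_pos.mp hodd.pos
      simp only [Finset.mem_filter, Finset.mem_univ, true_and] at hk
      obtain ⟨k1, k2, k3⟩ := hk
      have w1 : α.1 ∈ window N (2 ^ l) t := by rw [mem_window]; exact Or.inl a7
      have w2 : α.2 ∈ window N (2 ^ l) t := a7 ▸ mem_window_of_le hpos a1.1.le a5
      have w3 : β.1 ∈ window N (2 ^ l) t := by rw [mem_window]; exact Or.inl b7
      have w4 : β.2 ∈ window N (2 ^ l) t := b7 ▸ mem_window_of_le hpos b1.1.le b5
      rw [mem_window_iff hpos] at w1 w2 w3 w4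
      have k1' : β.1.val < k.val := k1
      have k2' : k.val < β.2.val := k2
      obtain ⟨c1, c2⟩ := a4 k k3 (by omega) (by omega)
      rcases a1.le_or_le b1 hH hne with h | h
      · exact absurd (c2.trans_le h) (not_lt.mpr k1.le)
      · exact absurd (h.trans_lt c1) (not_lt.mpr k2.le)
  · intro α hα
    simp only [richArcs, Finset.mem_filter, mem_arcs] at hα
    have h1 : α.1.val < α.2.val := hα.1.1
    have hx : 0 < α.2.val - α.1.val := by omega
    have hxN : α.2.val - α.1.val ≤ N := by omega
    generalize hxe : α.2.val - α.1.val = x at hx hxN ⊢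
    obtain ⟨a, ha1, ha2⟩ := exists_two_pow_near hx
    refine ⟨a, fun s hs => ⟨?_, ?_, ?_⟩⟩
    -- Here the scales may exceed `N` and run up to `K ^ 2 + K`, which is still below `3 * K ^ 2`.
    · have h3 : a < K ^ 2 + 1 := by
        rw [← Nat.pow_lt_pow_iff_right (a := 2) (by norm_num), pow_succ]
        omega
      nlinarith
    · have h2 : 2 ^ a ≤ 2 ^ (a + s) := Nat.pow_le_pow_right (by norm_num) (by omega)
      omega
    · have : 2 ^ (s + 1) ≤ 2 ^ K := Nat.pow_le_pow_right (by norm_num) hs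
      calc 2 * 2 ^ (a + s) = 2 ^ a * 2 ^ (s + 1) := by ring
        _ ≤ 2 * x * 2 ^ K := by gcongr
        _ = 2 ^ (K + 1) * x := by ring

end Gap

/-! ### Deleting moves while preserving parities -/

section Compression
variable {V : Type*} {G : SimpleGraph V} {N : ℕ} {H : Fin N → V}

lemma card_filter_lt_eq_add {T : Finset (Fin N)} {i j : Fin N} {v : V} (hij : i < j)
    (hi : H i ≠ v) :
    (T.filter fun k => k < j ∧ H k = v).card =
      (T.filter fun k => k < i ∧ H k = v).card +
        (T.filter fun k => i < k ∧ k < j ∧ H k = v).card := by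
  rw [← Finset.card_union_of_disjoint]
  · congr 1
    ext k
    simp only [Finset.mem_union, Finset.mem_filter]
    constructor
    · rintro ⟨h1, h2, h3⟩
      rcases lt_trichotomy k i with h | h | h
      · exact Or.inl ⟨h1, h, h3⟩
      · exact absurd (h ▸ h3) hi
      · exact Or.inr ⟨h1, h, h2, h3⟩
    · rintro (⟨h1, h2, h3⟩ | ⟨h1, h2, h3, h4⟩)
      · exact ⟨h1, h2.trans hij, h3⟩
      · exact ⟨h1, h3, h4⟩
  · rw [Finset.disjoint_left]
    intro k hk hk'
    simp only [Finset.mem_filter] at hk hk'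
    exact lt_asymm hk.2.1 hk'.2.1

/-- The arcs of length at most `Y` meeting `W` that pass over an endpoint of an arc in `A` at a
neighbouring node. -/
noncomputable def crossing (G : SimpleGraph V) (H : Fin N → V) (A : Finset (Fin N × Fin N))
    (W : Finset (Fin N)) (Y : ℕ) : Finset (Fin N × Fin N) :=
  (arcs H).filter fun β => (β.1 ∈ W ∨ β.2 ∈ W) ∧ β.2.val ≤ β.1.val + Y ∧
    ∃ α ∈ A, ∃ e, (e = α.1 ∨ e = α.2) ∧ G.Adj (H α.1) (H β.1) ∧ β.1 < e ∧ e < β.2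

/-- The nodes of the arcs in `A` and the neighbours that influence their improvement vectors. -/
def Influences (G : SimpleGraph V) (H : Fin N → V) (A : Finset (Fin N × Fin N)) (v : V) : Prop :=
  (∃ α ∈ A, H α.1 = v) ∨ ∃ α ∈ A, G.Adj (H α.1) v ∧ Odd (occInside H α v)

/-- The positions before which the parity of the number of moves of `v` has to be preserved. -/
def IsCut (G : SimpleGraph V) (H : Fin N → V) (A : Finset (Fin N × Fin N)) (v : V)
    (e : Fin N) : Prop :=
  (∃ α ∈ A, (e = α.1 ∨ e = α.2) ∧ G.Adj (H α.1) v) ∨ ∃ α ∈ A, e = α.1 ∧ H α.1 = v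

/-- `S` contains the endpoints of `A` and has the same parities as `W` before all cuts. -/
def IsAdmissible (G : SimpleGraph V) (H : Fin N → V) (A : Finset (Fin N × Fin N))
    (W S : Finset (Fin N)) : Prop :=
  A.image Prod.fst ∪ A.image Prod.snd ⊆ S ∧
    S ⊆ W.filter (fun p => Influences G H A (H p)) ∧
    ∀ v e, IsCut G H A v e → (S.filter fun k => k < e ∧ H k = v).card % 2 =
      ((W.filter fun p => Influences G H A (H p)).filter fun k => k < e ∧ H k = v).card % 2

/-- Two moves of the same node with no cut between them can be deleted. -/
lemma IsAdmissible.erase {A : Finset (Fin N × Fin N)} {W S : Finset (Fin N)}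
    (hS : IsAdmissible G H A W S) {p q : Fin N} (hp : p ∈ S) (hq : q ∈ S) (hpq : p < q)
    (hH : H q = H p) (hp' : p ∉ A.image Prod.fst ∪ A.image Prod.snd)
    (hq' : q ∉ A.image Prod.fst ∪ A.image Prod.snd)
    (hcut : ∀ e, IsCut G H A (H p) e → (p < e ↔ q < e)) :
    IsAdmissible G H A W ((S.erase p).erase q) := by
  obtain ⟨h1, h2, h3⟩ := hS
  refine ⟨?_, ?_, ?_⟩
  · intro x hx
    rw [Finset.mem_erase, Finset.mem_erase]
    refine ⟨?_, ?_, h1 hx⟩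
    · rintro rfl; exact hq' hx
    · rintro rfl; exact hp' hx
  · exact ((Finset.erase_subset _ _).trans (Finset.erase_subset _ _)).trans h2
  · intro v e he
    rw [← h3 v e he]
    by_cases hv : v = H p ∧ p < e
    · obtain ⟨rfl, hpe⟩ := hv
      have hqe := (hcut e he).mp hpe
      have : (S.filter fun k => k < e ∧ H k = H p) =
          insert p (insert q (((S.erase p).erase q).filter fun k => k < e ∧ H k = H p)) := by
        ext k
        simp only [Finset.mem_filter, Finset.mem_insert, Finset.mem_erase]
        constructor
        · rintro ⟨a, b, c⟩
          tauto
        · rintro (rfl | rfl | h)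
          · exact ⟨hp, hpe, rfl⟩
          · exact ⟨hq, hqe, hH⟩
          · exact ⟨h.1.2.2, h.2⟩
      rw [this, Finset.card_insert_of_notMem, Finset.card_insert_of_notMem]
      · omega
      · simp
      · simp [hpq.ne]
    · congr 2
      ext k
      simp only [Finset.mem_filter, Finset.mem_erase]
      constructor
      · rintro ⟨a, b⟩
        exact ⟨a.2.2, b⟩
      · rintro ⟨a, b, c⟩
        refine ⟨⟨?_, ?_, a⟩, b, c⟩
        · rintro rfl
          exact hv ⟨by rw [← c, hH], hpq.trans b⟩
        · rintro rfl
          exact hv ⟨c.symm, b⟩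

lemma exists_minimal_admissible {A : Finset (Fin N × Fin N)} {W : Finset (Fin N)}
    (hA : ∀ α ∈ A, IsArc H α ∧ α.1 ∈ W ∧ α.2 ∈ W) :
    ∃ S, IsAdmissible G H A W S ∧ ∀ S', IsAdmissible G H A W S' → S.card ≤ S'.card := by
  obtain ⟨S, hS, hmin⟩ := Finset.exists_min_image
    ((Finset.univ : Finset (Finset (Fin N))).filter (IsAdmissible G H A W)) Finset.card
    ⟨W.filter fun p => Influences G H A (H p), by
      rw [Finset.mem_filter]
      refine ⟨Finset.mem_univ _, ?_, subset_rfl, fun _ _ _ => rfl⟩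
      intro x hx
      rw [Finset.mem_filter]
      rcases Finset.mem_union.mp hx with h | h
      · obtain ⟨α, hα, rfl⟩ := Finset.mem_image.mp h
        exact ⟨(hA α hα).2.1, Or.inl ⟨α, hα, rfl⟩⟩
      · obtain ⟨α, hα, rfl⟩ := Finset.mem_image.mp h
        exact ⟨(hA α hα).2.2, Or.inl ⟨α, hα, (hA α hα).1.2.1⟩⟩⟩
  exact ⟨S, (Finset.mem_filter.mp hS).2, fun S' hS' => hmin S' (by simp [hS'])⟩

/-- Two consecutive surviving moves of a node, neither an endpoint of `A`, must have a cut between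
them, or both could be erased. A cut at a neighbouring arc's endpoint yields a crossing arc, and a
cut at the node's own arc is charged to that arc. The last such move of each node is charged to the
node, which carries an arc of `A` or, by `hpoor`, a crossing arc. With at most `2 * A.card`
endpoints this adds up to the bound. -/
lemma card_minimal_le [Fintype V] {A : Finset (Fin N × Fin N)} {W S : Finset (Fin N)} {Y : ℕ}
    (hW : ∀ p ∈ W, ∀ r ∈ W, ∀ q, p < q → q < r → q ∈ W)
    (hdiam : ∀ p ∈ W, ∀ q ∈ W, q.val ≤ p.val + Y)
    (hA : ∀ α ∈ A, IsArc H α ∧ α.1 ∈ W ∧ α.2 ∈ W)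
    (hpoor : ∀ α ∈ A, ∀ v, G.Adj (H α.1) v → Odd (occInside H α v) → ∃ p, H p = v ∧
      ((p < α.1 ∧ α.2.val ≤ p.val + Y) ∨ (α.2 < p ∧ p.val ≤ α.1.val + Y)))
    (hS : IsAdmissible G H A W S)
    (hmin : ∀ S', IsAdmissible G H A W S' → S.card ≤ S'.card) :
    S.card ≤ 2 * (crossing G H A W Y).card + 4 * A.card := by
  set P := A.image Prod.fst ∪ A.image Prod.snd with hP
  have hPcard : P.card ≤ 2 * A.card := by
    have h1 : P.card ≤ _ := Finset.card_union_le (A.image Prod.fst) (A.image Prod.snd)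
    have h2 : (A.image Prod.fst).card ≤ A.card := Finset.card_image_le
    have h3 : (A.image Prod.snd).card ≤ A.card := Finset.card_image_le
    omega
  have hSW : ∀ p ∈ S, p ∈ W ∧ Influences G H A (H p) := fun p hp =>
    Finset.mem_filter.mp (hS.2.1 hp)
  have hmemW : ∀ p ∈ W, ∀ r ∈ W, ∀ q, p ≤ q → q ≤ r → q ∈ W := by
    intro p hp r hr q h1 h2
    rcases h1.eq_or_lt with h | h
    · exact h ▸ hp
    · rcases h2.eq_or_lt with h' | h'
      · exact h' ▸ hr
      · exact hW p hp r hr q h h'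
  let D := S \ P
  let last : Fin N → Prop := fun p => ∀ q ∈ D, H q = H p → q ≤ p
  let passes : Fin N → Fin N × Fin N → Prop := fun p β => H β.1 = H p ∧ p ≤ β.1 ∧ β.1 < β.2 ∧
    ∀ q ∈ D, H q = H p → p < q → β.2 ≤ q
  let own : Fin N → Fin N × Fin N → Prop := fun p α => H α.1 = H p ∧ p < α.1 ∧
    ∀ q ∈ D, H q = H p → p < q → α.1 < q
  have hcases : ∀ p ∈ D, last p ∨ (∃ β ∈ crossing G H A W Y, passes p β) ∨ ∃ α ∈ A, own p α := by
    intro p hp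
    by_cases hl : last p
    · exact Or.inl hl
    right
    have hne : (D.filter fun q => H q = H p ∧ p < q).Nonempty := by
      simp only [last] at hl
      push Not at hl
      obtain ⟨q, h1, h2, h3⟩ := hl
      exact ⟨q, Finset.mem_filter.mpr ⟨h1, h2, h3⟩⟩
    have hq := Finset.min'_mem _ hne
    have hqmin : ∀ r ∈ D, H r = H p → p < r → Finset.min' _ hne ≤ r := fun r h1 h2 h3 =>
      Finset.min'_le _ r (Finset.mem_filter.mpr ⟨h1, h2, h3⟩)
    set q := Finset.min' _ hne
    obtain ⟨hqD, hqH, hpq⟩ := Finset.mem_filter.mp hq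
    have hpS := Finset.mem_sdiff.mp hp
    have hqS := Finset.mem_sdiff.mp hqD
    obtain ⟨e, he, hpe, hqe⟩ : ∃ e, IsCut G H A (H p) e ∧ p < e ∧ e ≤ q := by
      by_contra! hcon
      have hadm := hS.erase hpS.1 hqS.1 hpq hqH hpS.2 hqS.2
        (fun e he => ⟨fun h => hcon e he h, fun h => hpq.trans h⟩)
      have h1 := hmin _ hadm
      have h2 : ((S.erase p).erase q).card < S.card :=
        (Finset.card_le_card (Finset.erase_subset _ _)).trans_lt (Finset.card_erase_lt_of_mem hpS.1)
      omega
    -- Every cut is an endpoint of an arc in `A`, whereas `q` is not.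
    have hqe' : e < q := by
      refine lt_of_le_of_ne hqe ?_
      rintro rfl
      refine hqS.2 ?_
      rcases he with ⟨α, hα, h | h, -⟩ | ⟨α, hα, h, -⟩
      · exact Finset.mem_union_left _ (Finset.mem_image.mpr ⟨α, hα, h.symm⟩)
      · exact Finset.mem_union_right _ (Finset.mem_image.mpr ⟨α, hα, h.symm⟩)
      · exact Finset.mem_union_left _ (Finset.mem_image.mpr ⟨α, hα, h.symm⟩)
    rcases he with ⟨α, hα, hends, hadj⟩ | ⟨α, hα, rfl, hv⟩
    · left
      have hHe : H e ≠ H p := by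
        have : H e = H α.1 := by
          rcases hends with rfl | rfl
          · rfl
          · exact (hA α hα).1.2.1.symm
        rw [this]
        exact hadj.ne
      obtain ⟨β, h1, h2, h3, h4, h5, h6⟩ := exists_isArc_over hpe hqe' hqH.symm hHe
      have hpW := (hSW p hpS.1).1
      have hqW := (hSW q hqS.1).1
      have hb1 : β.1 ∈ W := hmemW p hpW q hqW _ h3 (h1.1.le.trans h6)
      have hb2 : β.2 ∈ W := hmemW p hpW q hqW _ (h3.trans h1.1.le) h6
      refine ⟨β, Finset.mem_filter.mpr ⟨mem_arcs.mpr h1, Or.inl hb1, hdiam _ hb1 _ hb2, α, hα, e,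
        hends, by rwa [h2], h4, h5⟩, h2, h3, h1.1, ?_⟩
      exact fun r h1 h2 h3 => h6.trans (hqmin r h1 h2 h3)
    · right
      exact ⟨α, hα, hv, hpe, fun r h1 h2 h3 => hqe'.trans_le (hqmin r h1 h2 h3)⟩
  have hsub : D ⊆ D.filter last ∪ (D.filter (fun p => ∃ β ∈ crossing G H A W Y, passes p β) ∪
      D.filter (fun p => ∃ α ∈ A, own p α)) := by
    intro p hp
    simp only [Finset.mem_union, Finset.mem_filter]
    rcases hcases p hp with h | h | h
    · exact Or.inl ⟨hp, h⟩
    · exact Or.inr (Or.inl ⟨hp, h⟩)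
    · exact Or.inr (Or.inr ⟨hp, h⟩)
  have hover : (D.filter (fun p => ∃ β ∈ crossing G H A W Y, passes p β)).card ≤
      (crossing G H A W Y).card := by
    refine Finset.card_le_card_of_forall_subsingleton passes ?_ ?_
    · exact fun p hp => (Finset.mem_filter.mp hp).2
    · intro β _ p hp p' hp'
      obtain ⟨hp, a1, a2, a3, a4⟩ := hp
      obtain ⟨hp', b1, b2, b3, b4⟩ := hp'
      have hpD := (Finset.mem_filter.mp hp).1
      have hpD' := (Finset.mem_filter.mp hp').1
      rcases lt_trichotomy p p' with h | h | h
      · exact absurd ((a4 p' hpD' (b1.symm.trans a1) h).trans b2) (not_le.mpr a3)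
      · exact h
      · exact absurd ((b4 p hpD (a1.symm.trans b1) h).trans a2) (not_le.mpr a3)
  have hown : (D.filter (fun p => ∃ α ∈ A, own p α)).card ≤ A.card := by
    refine Finset.card_le_card_of_forall_subsingleton own ?_ ?_
    · exact fun p hp => (Finset.mem_filter.mp hp).2
    · intro β _ p hp p' hp'
      obtain ⟨hp, a1, a2, a4⟩ := hp
      obtain ⟨hp', b1, b2, b4⟩ := hp'
      have hpD := (Finset.mem_filter.mp hp).1
      have hpD' := (Finset.mem_filter.mp hp').1
      rcases lt_trichotomy p p' with h | h | h
      · exact absurd ((a4 p' hpD' (b1.symm.trans a1) h).trans b2) (lt_irrefl _)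
      · exact h
      · exact absurd ((b4 p hpD (a1.symm.trans b1) h).trans a2) (lt_irrefl _)
  have hlast : (D.filter last).card ≤ A.card + (crossing G H A W Y).card := by
    have h1 : (D.filter last).card ≤
        (A.image (fun α => H α.1) ∪ (crossing G H A W Y).image fun β => H β.1).card := by
      refine Finset.card_le_card_of_injOn H ?_ ?_
      · intro p hp
        have hpD := (Finset.mem_filter.mp hp).1
        have hpS := (Finset.mem_sdiff.mp hpD).1
        rw [Finset.mem_coe, Finset.mem_union, Finset.mem_image, Finset.mem_image]
        rcases (hSW p hpS).2 with ⟨α, hα, h⟩ | ⟨α, hα, hadj, hodd⟩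
        · exact Or.inl ⟨α, hα, h⟩
        · right
          obtain ⟨k, hk⟩ := Finset.card_pos.mp hodd.pos
          simp only [Finset.mem_filter, Finset.mem_univ, true_and] at hk
          obtain ⟨k1, k2, k3⟩ := hk
          obtain ⟨harc, hα1, hα2⟩ := hA α hα
          have hkW : k ∈ W := hW _ hα1 _ hα2 k k1 k2
          -- The node occurs at `k` inside `α` and at `r` outside it nearby, so one of its arcs
          -- passes over the endpoint of `α` between them and has length at most `Y`.
          obtain ⟨r, hr, ⟨r1, r2⟩ | ⟨r1, r2⟩⟩ := hpoor α hα _ hadj hodd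
          · have hne : H α.1 ≠ H r := by rw [hr]; exact hadj.ne
            obtain ⟨β, c1, c2, c3, c4, c5, c6⟩ := exists_isArc_over r1 k1 (hr.trans k3.symm) hne
            have hb2 : β.2 ∈ W := hmemW _ hα1 _ hkW _ c5.le c6
            refine ⟨β, Finset.mem_filter.mpr ⟨mem_arcs.mpr c1, Or.inr hb2, ?_, α, hα, α.1,
              Or.inl rfl, ?_, c4, c5⟩, c2.trans hr⟩
            · have e1 : β.2.val ≤ k.val := c6
              have e2 : k.val < α.2.val := k2
              have e3 : r.val ≤ β.1.val := c3
              omega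
            · rw [c2, hr]; exact hadj
          · have hne : H α.2 ≠ H k := by rw [k3, ← harc.2.1]; exact hadj.ne
            obtain ⟨β, c1, c2, c3, c4, c5, c6⟩ := exists_isArc_over k2 r1 (k3.trans hr.symm) hne
            have hb1 : β.1 ∈ W := hmemW _ hkW _ hα2 _ c3 c4.le
            refine ⟨β, Finset.mem_filter.mpr ⟨mem_arcs.mpr c1, Or.inl hb1, ?_, α, hα, α.2,
              Or.inr rfl, ?_, c4, c5⟩, c2.trans k3⟩
            · have e1 : β.2.val ≤ r.val := c6
              have e2 : α.1.val < k.val := k1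
              have e3 : k.val ≤ β.1.val := c3
              omega
            · rw [c2, k3]; exact hadj
      · intro p hp p' hp' h
        obtain ⟨a1, a2⟩ := Finset.mem_filter.mp hp
        obtain ⟨b1, b2⟩ := Finset.mem_filter.mp hp'
        exact le_antisymm (b2 p a1 h) (a2 p' b1 h.symm)
    have h2 := Finset.card_union_le (A.image (fun α => H α.1))
      ((crossing G H A W Y).image fun β => H β.1)
    have h3 : (A.image fun α => H α.1).card ≤ A.card := Finset.card_image_le
    have h4 : ((crossing G H A W Y).image fun β => H β.1).card ≤ (crossing G H A W Y).card :=
      Finset.card_image_le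
    omega
  have hD : D.card ≤ (D.filter last).card +
      ((D.filter (fun p => ∃ β ∈ crossing G H A W Y, passes p β)).card +
      (D.filter (fun p => ∃ α ∈ A, own p α)).card) :=
    (Finset.card_le_card hsub).trans ((Finset.card_union_le _ _).trans
      (Nat.add_le_add_left (Finset.card_union_le _ _) _))
  have hSD : S.card ≤ P.card + D.card := by
    have h1 : S ⊆ P ∪ D := by
      intro x hx
      by_cases h : x ∈ P
      · exact Finset.mem_union_left _ h
      · exact Finset.mem_union_right _ (Finset.mem_sdiff.mpr ⟨hx, h⟩)
    exact (Finset.card_le_card h1).trans (Finset.card_union_le _ _)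
  omega

/-- Arcs at distinct nodes are few in comparison with the arcs passing over their endpoints. -/
theorem mul_card_le_crossing [Fintype V] {γ : Config H} {c Y : ℕ} (hn : IsNontrivial G H)
    (hno : ¬ RankBound G H γ (4 * c)) {A : Finset (Fin N × Fin N)} {W : Finset (Fin N)}
    (hW : ∀ p ∈ W, ∀ r ∈ W, ∀ q, p < q → q < r → q ∈ W)
    (hdiam : ∀ p ∈ W, ∀ q ∈ W, q.val ≤ p.val + Y)
    (hA : ∀ α ∈ A, IsArc H α ∧ α.1 ∈ W ∧ α.2 ∈ W)
    (hu : ∀ α ∈ A, ∀ β ∈ A, H α.1 = H β.1 → α = β)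
    (hpoor : ∀ α ∈ A, ∀ v, G.Adj (H α.1) v → Odd (occInside H α v) → ∃ p, H p = v ∧
      ((p < α.1 ∧ α.2.val ≤ p.val + Y) ∨ (α.2 < p ∧ p.val ≤ α.1.val + Y))) :
    c * A.card ≤ 2 * (crossing G H A W Y).card + 4 * A.card := by
  rcases A.eq_empty_or_nonempty with h | ⟨α₀, hα₀⟩
  · simp [h]
  by_contra! hlt
  obtain ⟨S, hS, hmin⟩ := exists_minimal_admissible (G := G) hA
  have hcard := card_minimal_le hW hdiam hA hpoor hS hmin
  obtain ⟨h1, h2, h3⟩ := hS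
  have hfst : ∀ α ∈ A, α.1 ∈ S := fun α hα =>
    h1 (Finset.mem_union_left _ (Finset.mem_image_of_mem _ hα))
  have hsnd : ∀ α ∈ A, α.2 ∈ S := fun α hα =>
    h1 (Finset.mem_union_right _ (Finset.mem_image_of_mem _ hα))
  refine hno (rankBound_of_selection γ (S := S) (A := A) (s := occPreceding H W) ⟨_, hfst _ hα₀⟩
    (fun α hα => ⟨(hA α hα).1, hfst α hα, hsnd α hα⟩)
    (witnessed_of_unique hn (fun α hα => (hA α hα).1) hu) ?_ ?_ (by omega))
  · intro α hα v hadj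
    obtain ⟨harc, ha1, ha2⟩ := hA α hα
    by_cases hR : Influences G H A v
    · have e1 := h3 v α.1 (Or.inl ⟨α, hα, Or.inl rfl, hadj⟩)
      have e2 := h3 v α.2 (Or.inl ⟨α, hα, Or.inr rfl, hadj⟩)
      rw [card_filter_lt_eq_add harc.1 hadj.ne, card_filter_lt_eq_add harc.1 hadj.ne] at e2
      have e3 : ((W.filter fun p => Influences G H A (H p)).filter
          fun k => α.1 < k ∧ k < α.2 ∧ H k = v).card = occInside H α v := by
        unfold occInside
        congr 1
        ext k
        simp only [Finset.mem_filter, Finset.mem_univ, true_and, and_iff_right_iff_imp]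
        rintro ⟨k1, k2, rfl⟩
        exact ⟨hW _ ha1 _ ha2 k k1 k2, hR⟩
      rw [e3] at e2
      omega
    -- All moves of a node without influence are deleted; this is harmless since it occurs evenly
    -- inside `α`.
    · have e1 : (S.filter fun k => α.1 < k ∧ k < α.2 ∧ H k = v).card = 0 := by
        rw [Finset.card_eq_zero, Finset.filter_eq_empty_iff]
        rintro k hk ⟨-, -, rfl⟩
        exact hR (Finset.mem_filter.mp (h2 hk)).2
      have e2 : ¬ Odd (occInside H α v) := fun h => hR (Or.inr ⟨α, hα, hadj, h⟩)
      rw [Nat.not_odd_iff] at e2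
      omega
  · intro α hα v hv
    have hR : Influences G H A v := by
      rcases hv with rfl | hv
      · exact Or.inl ⟨α, hα, rfl⟩
      · exact Or.inr ⟨α, hα, hv⟩
    have hcut : IsCut G H A v α.1 := by
      rcases hv with rfl | hv
      · exact Or.inr ⟨α, hα, rfl, rfl⟩
      · exact Or.inl ⟨α, hα, Or.inl rfl, hv.1⟩
    have e1 := h3 v α.1 hcut
    have e2 := card_filter_add_occPreceding (H := H) hW (hA α hα).2.1 v
    have e3 : ((W.filter fun p => Influences G H A (H p)).filter
        fun k => k < α.1 ∧ H k = v).card = (W.filter fun k => k < α.1 ∧ H k = v).card := by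
      congr 1
      ext k
      simp only [Finset.mem_filter, and_congr_left_iff, and_iff_left_iff_imp]
      rintro ⟨-, rfl⟩ _
      exact hR
    omega

end Compression

/-! ### Good arcs, scale by scale -/

section Scale
variable {V : Type*} {G : SimpleGraph V} {N : ℕ} {H : Fin N → V}

lemma card_window_le {Λ t : ℕ} (hΛ : 0 < Λ) : (window N Λ t).card ≤ 2 * Λ := by
  calc (window N Λ t).card ≤ (Finset.Ico (t * Λ) (t * Λ + 2 * Λ)).card := by
        refine Finset.card_le_card_of_injOn Fin.val ?_ (Fin.val_injective.injOn)
        intro p hp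
        rw [Finset.coe_Ico, Set.mem_Ico]
        exact (mem_window_iff hΛ).mp hp
    _ = 2 * Λ := by simp

/-- The arcs that are not short relative to the adjacent arcs and not rich. -/
noncomputable def goodArcs (G : SimpleGraph V) (H : Fin N → V) (K : ℕ) :
    Finset (Fin N × Fin N) :=
  arcs H \ (leftBad H (2 ^ (K + 2)) ∪ rightBad H (2 ^ (K + 2)) ∪ richArcs G H (2 ^ (K + 1)))

/-- The good arcs of length between `2 ^ l` and `2 ^ (l + 1)`. -/
noncomputable def goodArcsAt (G : SimpleGraph V) (H : Fin N → V) (K l : ℕ) :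
    Finset (Fin N × Fin N) :=
  (goodArcs G H K).filter fun α =>
    2 ^ l ≤ α.2.val - α.1.val ∧ α.2.val - α.1.val < 2 ^ (l + 1)

/-- The arcs whose length is comparable to `2 ^ l` up to a factor of about `2 ^ K`. -/
noncomputable def longArcs (H : Fin N → V) (K l : ℕ) : Finset (Fin N × Fin N) :=
  (arcs H).filter fun β => 2 ^ (l - (K + 4)) ≤ β.2.val - β.1.val ∧
    β.2.val ≤ β.1.val + 2 ^ (l + K + 3)

lemma isArc_of_mem_goodArcsAt {K l : ℕ} {α : Fin N × Fin N} (hα : α ∈ goodArcsAt G H K l) :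
    IsArc H α :=
  mem_arcs.mp (Finset.mem_sdiff.mp (Finset.mem_filter.mp hα).1).1

/-- Another occurrence close to an endpoint cannot be the other end of the arc, which is at least `2
^ l` away, nor lie inside it; outside, it would make the arc left or right bad. -/
lemma isolated_of_mem_goodArcsAt {K l D : ℕ} {α : Fin N × Fin N} (hα : α ∈ goodArcsAt G H K l)
    (hD : 2 ^ (K + 2) * (2 * D) ≤ 2 ^ l) {e k : Fin N} (he : e = α.1 ∨ e = α.2)
    (hk : H k = H α.1) (hke : k ≠ e) : k.val + 2 * D ≤ e.val ∨ e.val + 2 * D ≤ k.val := by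
  have harc := isArc_of_mem_goodArcsAt hα
  obtain ⟨hgood, hl1, -⟩ := Finset.mem_filter.mp hα
  obtain ⟨ha, hbad⟩ := Finset.mem_sdiff.mp hgood
  simp only [Finset.mem_union, not_or] at hbad
  obtain ⟨⟨hL, hR⟩, -⟩ := hbad
  have hlen : 2 * D ≤ 2 ^ l :=
    le_trans (Nat.le_mul_of_pos_left _ (by positivity)) hD
  have hlt : α.1.val < α.2.val := harc.1
  have hleft : k < α.1 → k.val + 2 * D ≤ α.1.val := by
    intro h
    by_contra! hcon
    refine hL (Finset.mem_filter.mpr ⟨ha, k, h, hk, ?_⟩)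
    refine le_trans (Nat.mul_le_mul_left _ ?_) (hD.trans hl1)
    omega
  have hright : α.2 < k → α.2.val + 2 * D ≤ k.val := by
    intro h
    by_contra! hcon
    refine hR (Finset.mem_filter.mpr ⟨ha, k, h, hk, ?_⟩)
    refine le_trans (Nat.mul_le_mul_left _ ?_) (hD.trans hl1)
    omega
  have hmid : ¬ (α.1 < k ∧ k < α.2) := fun h => harc.2.2 k h.1 h.2 hk
  simp only [Fin.lt_def, ne_eq, Fin.ext_iff] at hleft hright hmid hke
  rcases he with rfl | rfl <;> omega

/-- The arc is not rich, so `v` also occurs outside it at a distance bounded by `2 ^ (K + 1)` times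
its length; this supplies `hpoor` in the compression step. -/
lemma exists_outside_of_mem_goodArcsAt {K l : ℕ} {α : Fin N × Fin N}
    (hα : α ∈ goodArcsAt G H K l) {v : V} (hadj : G.Adj (H α.1) v)
    (hodd : Odd (occInside H α v)) :
    ∃ p, H p = v ∧ ((p < α.1 ∧ α.2.val ≤ p.val + 2 ^ (l + K + 3)) ∨
      (α.2 < p ∧ p.val ≤ α.1.val + 2 ^ (l + K + 3))) := by
  have harc := isArc_of_mem_goodArcsAt hα
  obtain ⟨hgood, -, hl2⟩ := Finset.mem_filter.mp hα
  obtain ⟨ha, hbad⟩ := Finset.mem_sdiff.mp hgood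
  simp only [Finset.mem_union, not_or] at hbad
  obtain ⟨-, hrich⟩ := hbad
  have h1 : ¬ ∀ p, H p = v → α.1.val ≤ p.val + 2 ^ (K + 1) * (α.2.val - α.1.val) →
      p.val ≤ α.2.val + 2 ^ (K + 1) * (α.2.val - α.1.val) → α.1 < p ∧ p < α.2 :=
    fun h => hrich (Finset.mem_filter.mpr ⟨ha, v, hadj, hodd, h⟩)
  push Not at h1
  obtain ⟨p, hp, h2, h3, h4⟩ := h1
  have hlt : α.1.val < α.2.val := harc.1
  have hY : 2 ^ (K + 1) * (α.2.val - α.1.val) + (α.2.val - α.1.val) ≤ 2 ^ (l + K + 3) := by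
    have e1 : 1 ≤ 2 ^ (K + 1) := Nat.one_le_two_pow
    calc 2 ^ (K + 1) * (α.2.val - α.1.val) + (α.2.val - α.1.val)
        = (2 ^ (K + 1) + 1) * (α.2.val - α.1.val) := by ring
      _ ≤ (2 ^ (K + 1) + 2 ^ (K + 1)) * 2 ^ (l + 1) := by gcongr
      _ = 2 ^ (l + K + 3) := by ring
  have n1 : p ≠ α.1 := by
    rintro rfl
    exact hadj.ne hp
  have n2 : p ≠ α.2 := by
    rintro rfl
    exact hadj.ne (harc.2.1.trans hp)
  refine ⟨p, hp, ?_⟩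
  rcases lt_or_gt_of_ne n1 with h | h
  · left
    have h' : p.val < α.1.val := h
    exact ⟨h, by omega⟩
  · right
    have h' : α.2 < p := lt_of_le_of_ne (h4 h) n2.symm
    exact ⟨h', by omega⟩

lemma exists_injOn_subset {ι κ : Type*} (s : Finset ι) (f : ι → κ) :
    ∃ t ⊆ s, (∀ x ∈ t, ∀ y ∈ t, f x = f y → x = y) ∧ t.card = (s.image f).card := by
  have h : ∀ y : s.image f, ∃ x ∈ s, f x = y := fun y => Finset.mem_image.mp y.2
  choose g hg1 hg2 using h
  refine ⟨Finset.univ.image g, ?_, ?_, ?_⟩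
  · intro x hx
    obtain ⟨y, -, rfl⟩ := Finset.mem_image.mp hx
    exact hg1 y
  · intro x hx x' hx' hxx
    obtain ⟨y, -, rfl⟩ := Finset.mem_image.mp hx
    obtain ⟨y', -, rfl⟩ := Finset.mem_image.mp hx'
    rw [hg2, hg2] at hxx
    rw [Subtype.ext hxx]
  · rw [Finset.card_image_of_injective, Finset.card_univ, Fintype.card_coe]
    intro y y' h
    exact Subtype.ext (by rw [← hg2 y, ← hg2 y', h])

/-- Short arcs passing over isolated endpoints of good arcs have small density. -/
lemma card_short_crossing [Finite V] {γ : Config H} {c K l t : ℕ}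
    (hno : ¬ RankBound G H γ (4 * c)) {A : Finset (Fin N × Fin N)}
    (hA : ∀ α ∈ A, α ∈ goodArcsAt G H K l ∧ α.1 ∈ window N (2 ^ (l + 1)) t ∧
      α.2 ∈ window N (2 ^ (l + 1)) t) {W : Finset (Fin N)} {Y : ℕ} :
    c * ((crossing G H A W Y).filter fun β =>
      β.2.val - β.1.val < 2 ^ (l - (K + 4))).card ≤ 6 * 2 ^ (l + 1) := by
  set X := (crossing G H A W Y).filter fun β => β.2.val - β.1.val < 2 ^ (l - (K + 4)) with hX
  rcases X.eq_empty_or_nonempty with h | ⟨β₀, hβ₀⟩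
  · simp [h]
  have hXmem : ∀ β ∈ X, IsArc H β ∧ β.2.val < β.1.val + 2 ^ (l - (K + 4)) ∧ ∃ α ∈ A, ∃ e,
      (e = α.1 ∨ e = α.2) ∧ G.Adj (H α.1) (H β.1) ∧ β.1 < e ∧ e < β.2 := by
    intro β hβ
    obtain ⟨h1, h2⟩ := Finset.mem_filter.mp hβ
    obtain ⟨h3, -, -, h4⟩ := Finset.mem_filter.mp h1
    rw [mem_arcs] at h3
    have h5 : β.1.val < β.2.val := h3.1
    exact ⟨h3, by omega, h4⟩
  have hl : K + 4 < l := by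
    by_contra! hcon
    obtain ⟨h1, h2, -⟩ := hXmem β₀ hβ₀
    rw [Nat.sub_eq_zero_of_le hcon] at h2
    have h5 : β₀.1.val < β₀.2.val := h1.1
    omega
  obtain ⟨d, rfl⟩ : ∃ d, l = d + (K + 4) := ⟨l - (K + 4), by omega⟩
  rw [Nat.add_sub_cancel] at hX hXmem
  set D := 2 ^ d with hDdef
  have hD : 0 < D := by positivity
  have hDl : 2 ^ (K + 2) * (2 * D) ≤ 2 ^ (d + (K + 4)) := by
    calc 2 ^ (K + 2) * (2 * D) = 2 ^ (d + (K + 3)) := by rw [hDdef]; ring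
      _ ≤ 2 ^ (d + (K + 4)) := Nat.pow_le_pow_right (by norm_num) (by omega)
  obtain ⟨g, hg, hg1⟩ : ∃ g, 2 ^ (d + (K + 4) + 1) = g * D ∧ 1 ≤ g :=
    ⟨2 ^ (K + 5), by rw [hDdef]; ring, Nat.one_le_two_pow⟩
  have hend : ∀ α ∈ A, ∀ e, (e = α.1 ∨ e = α.2) → e ∈ window N (2 ^ (d + (K + 4) + 1)) t ∧
      H e = H α.1 := by
    rintro α hα e (rfl | rfl)
    · exact ⟨(hA α hα).2.1, rfl⟩
    · exact ⟨(hA α hα).2.2, (isArc_of_mem_goodArcsAt (hA α hα).1).2.1.symm⟩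
  -- A crossing arc is shorter than `D`, so it may start one block before the large window but no
  -- earlier.
  have hfib : X.card = ∑ b ∈ Finset.Ico (t * g - 1) (t * g + 2 * g),
      (X.filter fun β => β.1.val / D = b).card := by
    refine Finset.card_eq_sum_card_fiberwise ?_
    intro β hβ
    obtain ⟨h1, h2, α, hα, e, he, -, h4, h5⟩ := hXmem β hβ
    have h6 := (hend α hα e he).1
    rw [mem_window_iff (by positivity), hg] at h6
    have h4' : β.1.val < e.val := h4
    have h5' : e.val < β.2.val := h5
    have h7 : t * g * D < (β.1.val / D + 2) * D := by
      have := Nat.lt_div_mul_add hD (a := β.1.val)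
      nlinarith
    have h8 : β.1.val / D * D < (t * g + 2 * g) * D := by
      have := Nat.div_mul_le_self β.1.val D
      nlinarith
    have h9 := Nat.lt_of_mul_lt_mul_right h7
    have h10 := Nat.lt_of_mul_lt_mul_right h8
    rw [Finset.coe_Ico, Set.mem_Ico]
    beta_reduce
    clear h7 h8
    generalize β.1.val / D = z at h9 h10 ⊢
    omega
  have hterm : ∀ b, c * (X.filter fun β => β.1.val / D = b).card ≤ 2 * D := by
    intro b
    refine le_trans (mul_card_le_card_window (t := b) (Λ := D) hno ?_ ?_) (card_window_le hD)
    · intro β hβ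
      obtain ⟨hβX, rfl⟩ := Finset.mem_filter.mp hβ
      obtain ⟨h1, h2, -⟩ := hXmem β hβX
      exact ⟨h1, mem_window_of_le hD le_rfl (by omega), mem_window_of_le hD h1.1.le h2.le⟩
    · refine witnessed_of_forall_exists fun β hβ => ?_
      obtain ⟨hβX, hb⟩ := Finset.mem_filter.mp hβ
      obtain ⟨h1, h2, α, hα, e, he, hadj, h4, h5⟩ := hXmem β hβX
      have huniq : ∀ k ∈ window N D b, H k = H α.1 → k = e := by
        intro k hk hHk
        by_contra hne
        have hew : e ∈ window N D b := by
          refine ordConnected_window _ ?_ _ ?_ e h4 h5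
          · exact mem_window.mpr (Or.inl hb)
          · exact hb ▸ mem_window_of_le hD h1.1.le h2.le
        have h6 := isolated_of_mem_goodArcsAt (hA α hα).1 hDl he hHk hne
        rw [mem_window_iff hD] at hk hew
        omega
      have hin : ∀ β' ∈ X, β'.1.val / D = b → ∀ k, β'.1 < k → k < β'.2 →
          k ∈ window N D b := by
        intro β' hβ' hb' k k1 k2
        obtain ⟨h1', h2', -⟩ := hXmem β' hβ'
        refine ordConnected_window _ ?_ _ ?_ k k1 k2
        · exact mem_window.mpr (Or.inl hb')
        · exact hb' ▸ mem_window_of_le hD h1'.1.le h2'.le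
      -- The witness is the node of the good arc crossed: in this window of length `2 * D` it occurs
      -- only at `e`, which two arcs at the same node cannot both pass over.
      refine ⟨H α.1, hadj.symm, ?_, ?_⟩
      · have : occInside H β (H α.1) = 1 := by
          unfold occInside
          rw [Finset.card_eq_one]
          refine ⟨e, ?_⟩
          ext k
          simp only [Finset.mem_filter, Finset.mem_univ, true_and, Finset.mem_singleton]
          constructor
          · rintro ⟨k1, k2, k3⟩
            exact huniq k (hin β hβX hb k k1 k2) k3
          · rintro rfl
            exact ⟨h4, h5, (hend α hα k he).2⟩
        rw [this]
        exact odd_one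
      · intro β' hβ' hne hH hodd
        obtain ⟨hβX', hb'⟩ := Finset.mem_filter.mp hβ'
        obtain ⟨k, hk⟩ := Finset.card_pos.mp hodd.pos
        simp only [Finset.mem_filter, Finset.mem_univ, true_and] at hk
        obtain ⟨k1, k2, k3⟩ := hk
        have hke := huniq k (hin β' hβX' hb' k k1 k2) k3
        subst hke
        rcases h1.le_or_le (hXmem β' hβX').1 hH hne with h | h
        · exact absurd ((h5.trans_le h).trans k1) (lt_irrefl _)
        · exact absurd ((k2.trans_le h).trans h4) (lt_irrefl _)
  rw [hfib, Finset.mul_sum]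
  calc ∑ b ∈ Finset.Ico (t * g - 1) (t * g + 2 * g), c * (X.filter fun β => β.1.val / D = b).card
      ≤ (Finset.Ico (t * g - 1) (t * g + 2 * g)).card • (2 * D) :=
        Finset.sum_le_card_nsmul _ _ _ fun b _ => hterm b
    _ ≤ (3 * g) * (2 * D) := by
        rw [smul_eq_mul, Nat.card_Ico]
        exact Nat.mul_le_mul_right _ (by omega)
    _ = 6 * 2 ^ (d + (K + 4) + 1) := by rw [hg]; ring

/-- One factor `c` comes from the compression bound on the chosen arcs; the second is spent on the
bound for the short crossing arcs. -/
lemma card_goodArcsAt_block [Fintype V] {γ : Config H} {c K l t : ℕ} (hn : IsNontrivial G H)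
    (hno : ¬ RankBound G H γ (4 * c)) (hc : 8 ≤ c) :
    c * (c * ((goodArcsAt G H K l).filter fun α => α.1.val / 2 ^ (l + 1) = t).card) ≤
      8 * (6 * 2 ^ (l + 1) + c * (((longArcs H K l).filter fun β =>
        β.1 ∈ window N (2 ^ (l + 1)) t).card + ((longArcs H K l).filter fun β =>
        β.2 ∈ window N (2 ^ (l + 1)) t).card)) := by
  set A₀ := (goodArcsAt G H K l).filter fun α => α.1.val / 2 ^ (l + 1) = t with hA₀
  set W := window N (2 ^ (l + 1)) t with hW
  have hpos : 0 < 2 ^ (l + 1) := by positivity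
  have hA₀mem : ∀ α ∈ A₀, α ∈ goodArcsAt G H K l ∧ α.1 ∈ W ∧ α.2 ∈ W := by
    intro α hα
    obtain ⟨h1, h2⟩ := Finset.mem_filter.mp hα
    have h3 := (Finset.mem_filter.mp h1).2.2
    have h4 := isArc_of_mem_goodArcsAt h1
    refine ⟨h1, mem_window.mpr (Or.inl h2), ?_⟩
    rw [hW, ← h2]
    exact mem_window_of_le hpos h4.1.le (by omega)
  -- Arcs of length at least `2 ^ l` at one node start in different half-blocks of length `2 ^ l`,
  -- so at most two of them start in one block.
  have hfib : A₀.card ≤ 2 * (A₀.image fun α => H α.1).card := by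
    refine Finset.card_le_mul_card_image _ _ fun u _ => ?_
    refine (Finset.card_le_card_of_injOn (t := {2 * t, 2 * t + 1})
      (fun α => α.1.val / 2 ^ l) ?_ ?_).trans Finset.card_le_two
    · intro α hα
      have h1 := (Finset.mem_filter.mp (Finset.mem_filter.mp hα).1).2
      rw [pow_succ, ← Nat.div_div_eq_div_mul] at h1
      simp only [Finset.coe_insert, Finset.coe_singleton, Set.mem_insert_iff,
        Set.mem_singleton_iff]
      omega
    · have key : ∀ α ∈ A₀, ∀ β : Fin N × Fin N, α.2 ≤ β.1 →
          α.1.val / 2 ^ l ≠ β.1.val / 2 ^ l := by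
        intro α hα β h heq
        have h1 := (Finset.mem_filter.mp (hA₀mem α hα).1).2.1
        have h2 := Nat.lt_div_mul_add (b := 2 ^ l) (by positivity) (a := β.1.val)
        have h3 := Nat.div_mul_le_self α.1.val (2 ^ l)
        have h4 : α.2.val ≤ β.1.val := h
        have h5 : 0 < 2 ^ l := by positivity
        rw [heq] at h3
        omega
      intro α hα β hβ h
      obtain ⟨hα, ha⟩ := Finset.mem_filter.mp hα
      obtain ⟨hβ, hb⟩ := Finset.mem_filter.mp hβ
      by_contra hne
      rcases (isArc_of_mem_goodArcsAt (hA₀mem α hα).1).le_or_le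
        (isArc_of_mem_goodArcsAt (hA₀mem β hβ).1) (ha.trans hb.symm) hne with h' | h'
      · exact key α hα β h' h
      · exact key β hβ α h' h.symm
  obtain ⟨A, hAA₀, hinj, hcardA⟩ := exists_injOn_subset A₀ fun α => H α.1
  have hmain := mul_card_le_crossing (Y := 2 ^ (l + K + 3)) hn hno (A := A) (W := W)
    ordConnected_window ?_ ?_ hinj ?_
  · have hshort := card_short_crossing (W := W) (Y := 2 ^ (l + K + 3)) hno
      (fun α hα => hA₀mem α (hAA₀ hα))
    have hlong : ((crossing G H A W (2 ^ (l + K + 3))).filter fun β =>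
        ¬ β.2.val - β.1.val < 2 ^ (l - (K + 4))).card ≤
        ((longArcs H K l).filter fun β => β.1 ∈ W).card +
          ((longArcs H K l).filter fun β => β.2 ∈ W).card := by
      refine le_trans (Finset.card_le_card ?_) (Finset.card_union_le _ _)
      intro β hβ
      obtain ⟨h1, h2⟩ := Finset.mem_filter.mp hβ
      obtain ⟨h3, h4, h5, -⟩ := Finset.mem_filter.mp h1
      have h6 : β ∈ longArcs H K l := Finset.mem_filter.mpr ⟨h3, not_lt.mp h2, h5⟩
      rcases h4 with h | h
      · exact Finset.mem_union_left _ (Finset.mem_filter.mpr ⟨h6, h⟩)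
      · exact Finset.mem_union_right _ (Finset.mem_filter.mpr ⟨h6, h⟩)
    have hsplit := Finset.card_filter_add_card_filter_not (s := crossing G H A W (2 ^ (l + K + 3)))
      (fun β => β.2.val - β.1.val < 2 ^ (l - (K + 4)))
    set x := ((crossing G H A W (2 ^ (l + K + 3))).filter fun β =>
      β.2.val - β.1.val < 2 ^ (l - (K + 4))).card
    set q := ((longArcs H K l).filter fun β => β.1 ∈ W).card +
          ((longArcs H K l).filter fun β => β.2 ∈ W).card
    -- Since `8 ≤ c`, the term `4 * A.card` in `hmain` is absorbed into half of the left-hand side.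
    have h1 : c * A.card ≤ 4 * (x + q) := by
      have : 8 * A.card ≤ c * A.card := Nat.mul_le_mul_right _ hc
      omega
    have h2 : c * A₀.card ≤ 8 * (x + q) := by
      rw [← hcardA] at hfib
      have := Nat.mul_le_mul_left c hfib
      have e : c * (2 * A.card) = 2 * (c * A.card) := by ring
      omega
    calc c * (c * A₀.card) ≤ c * (8 * (x + q)) := Nat.mul_le_mul_left _ h2
      _ = 8 * (c * x + c * q) := by ring
      _ ≤ 8 * (6 * 2 ^ (l + 1) + c * q) := by gcongr
  · intro p hp q hq
    rw [hW, mem_window_iff hpos] at hp hq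
    have : 2 * 2 ^ (l + 1) ≤ 2 ^ (l + K + 3) := by
      rw [← pow_succ']
      exact Nat.pow_le_pow_right (by norm_num) (by omega)
    omega
  · intro α hα
    have h := hA₀mem α (hAA₀ hα)
    exact ⟨isArc_of_mem_goodArcsAt h.1, h.2⟩
  · intro α hα v hadj hodd
    exact exists_outside_of_mem_goodArcsAt (hA₀mem α (hAA₀ hα)).1 hadj hodd

lemma card_goodArcsAt [Fintype V] {γ : Config H} {c K l : ℕ} (hn : IsNontrivial G H)
    (hno : ¬ RankBound G H γ (4 * c)) (hc : 8 ≤ c) :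
    c * (c * (goodArcsAt G H K l).card) ≤ 144 * N + 32 * (c * (longArcs H K l).card) := by
  rcases (goodArcsAt G H K l).eq_empty_or_nonempty with h | ⟨α₀, hα₀⟩
  · simp [h]
  have hl : 2 ^ l ≤ N := by
    have := (Finset.mem_filter.mp hα₀).2.1
    omega
  set Λ := 2 ^ (l + 1) with hΛ
  have hΛN : Λ ≤ 2 * N := by rw [hΛ, pow_succ]; omega
  set T := N / Λ + 1
  have hfib : (goodArcsAt G H K l).card = ∑ t ∈ Finset.range T,
      ((goodArcsAt G H K l).filter fun α => α.1.val / Λ = t).card := by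
    refine Finset.card_eq_sum_card_fiberwise fun α _ => ?_
    rw [Finset.coe_range, Set.mem_Iio]
    exact Nat.lt_succ_of_le (Nat.div_le_div_right α.1.isLt.le)
  have h1 := sum_card_filter_window (longArcs H K l) Prod.fst Λ T
  have h2 := sum_card_filter_window (longArcs H K l) Prod.snd Λ T
  -- The last block may be incomplete; `Λ ≤ 2 * N`, from the existence of a good arc at this scale,
  -- keeps the excess bounded.
  have hTΛ : T * Λ ≤ 3 * N := by
    have := Nat.div_mul_le_self N Λ
    have e : T * Λ = N / Λ * Λ + Λ := by ring
    omega
  calc c * (c * (goodArcsAt G H K l).card)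
      = ∑ t ∈ Finset.range T,
        c * (c * ((goodArcsAt G H K l).filter fun α => α.1.val / Λ = t).card) := by
        rw [hfib, Finset.mul_sum, Finset.mul_sum]
    _ ≤ ∑ t ∈ Finset.range T, 8 * (6 * Λ + c * (((longArcs H K l).filter fun β =>
        β.1 ∈ window N Λ t).card + ((longArcs H K l).filter fun β =>
        β.2 ∈ window N Λ t).card)) :=
        Finset.sum_le_sum fun t _ => card_goodArcsAt_block hn hno hc
    _ = 48 * (T * Λ) + 8 * (c * (∑ t ∈ Finset.range T, ((longArcs H K l).filter fun β =>
        β.1 ∈ window N Λ t).card + ∑ t ∈ Finset.range T, ((longArcs H K l).filter fun β =>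
        β.2 ∈ window N Λ t).card)) := by
        rw [← Finset.mul_sum, Finset.sum_add_distrib, ← Finset.mul_sum, ← Finset.mul_sum,
          Finset.sum_add_distrib, Finset.sum_const, Finset.card_range, smul_eq_mul]
        ring
    _ ≤ 48 * (3 * N) + 8 * (c * (2 * (longArcs H K l).card + 2 * (longArcs H K l).card)) := by
        gcongr
    _ = 144 * N + 32 * (c * (longArcs H K l).card) := by ring

lemma card_arcs_le (H : Fin N → V) : (arcs H).card ≤ N := by
  have : (arcs H).card ≤ (Finset.univ : Finset (Fin N)).card :=
    Finset.card_le_card_of_injOn Prod.fst (fun _ _ => Finset.mem_univ _) fun α hα β hβ h =>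
      (mem_arcs.mp hα).eq_of_fst_eq (mem_arcs.mp hβ) h
  simpa using this

/-- The binary logarithm of the length of an arc confines `l` to an interval of `2 * K + 8 ≤ 10 * K`
values. -/
lemma sum_card_longArcs {K M : ℕ} (hK : 1 ≤ K) :
    ∑ l ∈ Finset.range M, (longArcs H K l).card ≤ 10 * K * N := by
  have h := Finset.sum_card_bipartiteAbove_eq_sum_card_bipartiteBelow
    (s := Finset.range M) (t := arcs H) (fun l β => 2 ^ (l - (K + 4)) ≤ β.2.val - β.1.val ∧
    β.2.val ≤ β.1.val + 2 ^ (l + K + 3))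
  unfold Finset.bipartiteAbove Finset.bipartiteBelow at h
  unfold longArcs
  rw [h]
  refine (Finset.sum_le_card_nsmul _ _ (10 * K) fun β hβ => ?_).trans ?_
  · rw [mem_arcs] at hβ
    have h1 : β.1.val < β.2.val := hβ.1
    have hx : β.2.val - β.1.val ≠ 0 := by omega
    refine (Finset.card_le_card (t := Finset.Icc (Nat.log 2 (β.2.val - β.1.val) - (K + 3))
      (Nat.log 2 (β.2.val - β.1.val) + (K + 4))) ?_).trans ?_
    · intro l hl
      obtain ⟨-, h2, h3⟩ := Finset.mem_filter.mp hl
      have h4 := (Nat.le_log_iff_pow_le (by norm_num) hx).mpr h2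
      have h5 : Nat.log 2 (β.2.val - β.1.val) ≤ l + K + 3 := by
        have := Nat.log_mono_right (b := 2) (show β.2.val - β.1.val ≤ 2 ^ (l + K + 3) by omega)
        rwa [Nat.log_pow (by norm_num)] at this
      rw [Finset.mem_Icc]
      omega
    · rw [Nat.card_Icc]
      omega
  · rw [smul_eq_mul, mul_comm]
    exact Nat.mul_le_mul_left _ (card_arcs_le H)

theorem card_goodArcs [Fintype V] {γ : Config H} {C K : ℕ} (hK : 1 ≤ K) (hN : N < 2 ^ K ^ 2)
    (hn : IsNontrivial G H) (hno : ¬ RankBound G H γ (4 * (C * K))) (hC : 8 ≤ C) :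
    C * (C * (goodArcs G H K).card) ≤ 144 * N + 320 * (C * N) := by
  have hfib : (goodArcs G H K).card = ∑ l ∈ Finset.range (K ^ 2), (goodArcsAt G H K l).card := by
    have h := Finset.card_eq_sum_card_fiberwise (s := goodArcs G H K)
      (t := Finset.range (K ^ 2)) (f := fun α => Nat.log 2 (α.2.val - α.1.val)) ?_
    · rw [h]
      refine Finset.sum_congr rfl fun l _ => ?_
      unfold goodArcsAt
      congr 1
      ext α
      simp only [Finset.mem_filter, and_congr_right_iff]
      intro hα
      have h1 : α.1.val < α.2.val := (mem_arcs.mp (Finset.mem_sdiff.mp hα).1).1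
      exact Nat.log_eq_iff (Or.inr ⟨by norm_num, by omega⟩)
    · intro α hα
      have h1 : α.1.val < α.2.val := (mem_arcs.mp (Finset.mem_sdiff.mp hα).1).1
      rw [Finset.coe_range, Set.mem_Iio]
      refine Nat.log_lt_of_lt_pow (by omega) (by omega)
  have hc : 8 ≤ C * K := by nlinarith
  have h1 : C * K * (C * K * (goodArcs G H K).card) ≤
      K ^ 2 * (144 * N) + 32 * (C * K * (10 * K * N)) := by
    calc C * K * (C * K * (goodArcs G H K).card)
        = ∑ l ∈ Finset.range (K ^ 2), C * K * (C * K * (goodArcsAt G H K l).card) := by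
          rw [hfib, Finset.mul_sum, Finset.mul_sum]
      _ ≤ ∑ l ∈ Finset.range (K ^ 2), (144 * N + 32 * (C * K * (longArcs H K l).card)) :=
          Finset.sum_le_sum fun l _ => card_goodArcsAt hn hno hc
      _ = K ^ 2 * (144 * N) +
          32 * (C * K * ∑ l ∈ Finset.range (K ^ 2), (longArcs H K l).card) := by
          rw [Finset.sum_add_distrib, Finset.sum_const, Finset.card_range, smul_eq_mul]
          simp only [Finset.mul_sum]
      _ ≤ _ := by
          gcongr
          exact sum_card_longArcs hK
  have h2 : K ^ 2 * (C * (C * (goodArcs G H K).card)) ≤ K ^ 2 * (144 * N + 320 * (C * N)) := by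
    nlinarith
  exact Nat.le_of_mul_le_mul_left h2 (by positivity)

/-- Nontrivial sequences with at least five times as many moves as nodes have a subsequence of large rank. -/
theorem rankBound_of_isNontrivial [Fintype V] (γ : Config H) {K : ℕ} (hK : 1 ≤ K)
    (hN : N < 2 ^ K ^ 2) (hN₀ : 0 < N) (hV : 5 * Fintype.card V ≤ N) (hn : IsNontrivial G H) :
    RankBound G H γ (4 * (1000 * K)) := by
  by_contra hno
  have h1 := card_leftBad hK hN hn hno
  have h2 := card_rightBad hK hN hn hno
  have h3 := card_richArcs hK hN hno
  have h4 := card_goodArcs hK hN hn hno (by norm_num)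
  have h5 := card_le_card_arcs_add H
  have h6 : (arcs H).card ≤ (goodArcs G H K).card + ((leftBad H (2 ^ (K + 2))).card +
      (rightBad H (2 ^ (K + 2))).card + (richArcs G H (2 ^ (K + 1))).card) := by
    have e1 := Finset.le_card_sdiff (leftBad H (2 ^ (K + 2)) ∪ rightBad H (2 ^ (K + 2)) ∪
      richArcs G H (2 ^ (K + 1))) (arcs H)
    have e2 := Finset.card_union_le (leftBad H (2 ^ (K + 2)) ∪ rightBad H (2 ^ (K + 2)))
      (richArcs G H (2 ^ (K + 1)))
    have e3 := Finset.card_union_le (leftBad H (2 ^ (K + 2))) (rightBad H (2 ^ (K + 2)))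
    unfold goodArcs
    omega
  -- With `C = 1000` the three bad classes hold at most `18 * N / 1000` arcs and the good class less
  -- than `N / 3`, short of the `4 * N / 5` arcs that exist.
  omega

end Scale

/-! ### Numerical constants and conclusion -/

lemma sqrt_log_add_one_le {n : ℕ} (hn : 2 ≤ n) :
    ((Nat.sqrt (Nat.log 2 (5 * n)) + 1 : ℕ) : ℝ) ≤ 5 * √(Real.log n) := by
  have hn' : (2 : ℝ) ≤ n := by exact_mod_cast hn
  have hlog2 := Real.log_two_gt_d9
  have hlogn : Real.log 2 ≤ Real.log n := Real.log_le_log (by norm_num) hn'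
  have h1 : (Nat.log 2 (5 * n) : ℝ) * Real.log 2 ≤ 4 * Real.log n := by
    have h2 : 2 ^ Nat.log 2 (5 * n) ≤ n ^ 4 := by
      refine (Nat.pow_log_le_self 2 (by omega)).trans ?_
      have : 2 ^ 3 ≤ n ^ 3 := Nat.pow_le_pow_left hn 3
      calc 5 * n ≤ n ^ 3 * n := by gcongr; omega
        _ = n ^ 4 := by ring
    have h3 : ((2 : ℝ) ^ Nat.log 2 (5 * n)) ≤ (n : ℝ) ^ 4 := by exact_mod_cast h2
    have h4 := Real.log_le_log (by positivity) h3
    rw [Real.log_pow, Real.log_pow] at h4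
    exact_mod_cast h4
  -- The factor `9` is a convenient square above `4 / log 2`; its root `3`, plus `2` for the summand
  -- `1`, gives the constant `5`.
  have h2 : (Nat.log 2 (5 * n) : ℝ) ≤ 9 * Real.log n := by nlinarith
  have h3 : (Nat.sqrt (Nat.log 2 (5 * n)) : ℝ) ≤ 3 * √(Real.log n) := by
    calc (Nat.sqrt (Nat.log 2 (5 * n)) : ℝ) ≤ √(Nat.log 2 (5 * n) : ℝ) := Real.nat_sqrt_le_real_sqrt
      _ ≤ √(3 ^ 2 * Real.log n) := Real.sqrt_le_sqrt (by linarith)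
      _ = 3 * √(Real.log n) := by
        rw [Real.sqrt_mul (by norm_num), Real.sqrt_sq (by norm_num)]
  have h4 : (1 : ℝ) ≤ 2 * √(Real.log n) := by
    have : (1 / 2 : ℝ) ≤ √(Real.log n) := Real.le_sqrt_of_sq_le (by linarith)
    linarith
  push_cast
  linarith

end LocalMaxCut

/-- The constant `c` is absolute. The map `f` exhibits `B` as a subsequence of `H`. -/
theorem lemma3p1 :
    ∃ c : ℝ, 0 < c ∧
      ∀ (V : Type*) [Fintype V] (G : SimpleGraph V), 2 ≤ Fintype.card V →
        ∀ H : Fin (5 * Fintype.card V) → V, LocalMaxCut.IsNontrivial G H →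
          ∀ γ : LocalMaxCut.Config H,
            ∃ (k : ℕ) (B : Fin k → V) (τ : LocalMaxCut.Config B) (Q : Finset (Fin k × Fin k)),
              0 < k ∧ k ≤ 5 * Fintype.card V ∧
              (∃ f : Fin k → Fin (5 * Fintype.card V), StrictMono f ∧ B = H ∘ f) ∧
              (∀ α ∈ Q, LocalMaxCut.IsArc B α) ∧
              c / √(Real.log (Fintype.card V)) ≤ (LocalMaxCut.rank G B Q : ℝ) / (k : ℝ) ∧
              ∀ α ∈ Q, ∃ α' : Fin (5 * Fintype.card V) × Fin (5 * Fintype.card V),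
                LocalMaxCut.IsArc H α' ∧
                LocalMaxCut.improvement G B τ α = LocalMaxCut.improvement G H γ α' := by
  -- The denominator is `4 * 1000 * 5`: the loss in `rankBound_of_isNontrivial` times the ratio of
  -- `K` to `√(log n)`.
  refine ⟨1 / 20000, by norm_num, ?_⟩
  intro V _ G hV H hn γ
  have hN : 5 * Fintype.card V < 2 ^ (Nat.sqrt (Nat.log 2 (5 * Fintype.card V)) + 1) ^ 2 := by
    refine (Nat.lt_pow_succ_log_self (b := 2) (by norm_num) _).trans_le ?_
    refine Nat.pow_le_pow_right (by norm_num) ?_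
    exact Nat.lt_succ_sqrt' _
  obtain ⟨k, B, τ, Q, hk0, hk, hsub, harc, hrank, himp⟩ :=
    LocalMaxCut.rankBound_of_isNontrivial γ (Nat.le_add_left 1 _) hN (by omega) le_rfl hn
  refine ⟨k, B, τ, Q, hk0, hk, hsub, harc, ?_, himp⟩
  have hK := LocalMaxCut.sqrt_log_add_one_le hV
  set K := Nat.sqrt (Nat.log 2 (5 * Fintype.card V)) + 1
  have hlog : 0 < Real.log (Fintype.card V) :=
    Real.log_pos (by exact_mod_cast lt_of_lt_of_le one_lt_two hV)
  have hs : 0 < √(Real.log (Fintype.card V)) := Real.sqrt_pos.mpr hlog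
  have hk' : (0 : ℝ) < k := by exact_mod_cast hk0
  have hr : (k : ℝ) ≤ 4 * (1000 * K) * LocalMaxCut.rank G B Q := by exact_mod_cast hrank
  rw [div_le_div_iff₀ hs hk']
  have h0 : (0 : ℝ) ≤ LocalMaxCut.rank G B Q := Nat.cast_nonneg _
  have h1 := mul_le_mul_of_nonneg_right hK h0
  nlinarith
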